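/- Let $\mathfrak g=\mathfrak{sl}(2,\mathbb C)$, let $U$ be its enveloping algebra and $S=S(\mathfrak g)$ its symmetric algebra, i.e. the graded Poisson algebra of polynomial functions on $\mathfrak g^*$, with $\{x,y\}=[x,y]$ for $x,y\in\mathfrak g$. Let $\mathcal O_{\min}\subset\mathfrak g^*$ be the minimal nonzero nilpotent coadjoint orbit, $I\subset S$ the ideal of functions vanishing on $\mathcal O_{\min}$, and $\mathcal R=S/I=\bigoplus_{d\ge 0}\mathcal R^d$ with the induced grading and Poisson bracket (put $\mathcal R^d=0$ for $d<0$). For $x\in\mathfrak g$ let $\mu_x\in\mathcal R^1$ be the image of $x$. A graded star product on $\mathcal R$ is an associative $\mathbb C[t]$-bilinear product $\star$ on $\mathcal R[t]$ such that, writing $f\star g=\sum_{p\ge0}C_p(f,g)t^p$ for $f,g\in\mathcal R$: (i) $C_0(f,g)=fg$; (ii) $C_1(f,g)-C_1(g,f)=\{f,g\}$; (iii) $C_p(f,g)=(-1)^pC_p(g,f)$; (iv) $C_p(f,g)\in\mathcal R^{k+l-p}$ for $f\in\mathcal R^k$, $g\in\mathcal R^l$. It is $G$-equivariant if $\mu_x\star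 f-f\star\mu_x=t\{\mu_x,f\}$ for all $x\in\mathfrak g$, $f\in\mathcal R$. Put $f\circ g=(f\star g)|_{t=1}$. A $G$-equivariant graded star product $\star$ corresponds to the ideal $J$ of $U$ if $J$ is the kernel of the algebra homomorphism $\Psi:U\to(\mathcal R,\circ)$ with $\Psi(x_1\cdots x_d)=\mu_{x_1}\circ\cdots\circ\mu_{x_d}$ for $x_i\in\mathfrak g$. For $\lambda\in\mathbb C$ let $\mathfrak D^\lambda(\mathbb P^1)$ be the algebra of global sections of the sheaf of twisted differential operators acting on local sections of the $\lambda$-th power of the canonical bundle of $\mathbb P^1=\mathbb{CP}^1$, let $\Phi^\lambda:U\to\mathfrak D^\lambda(\mathbb P^1)$ be the algebra homomorphism given by the infinitesimal action of $\mathfrak g$ (in the coordinate $z$ on the big cell, $x=\begin{pmatrix}a&b\\c&-a\end{pmatrix}$ acts on coefficients of $(dz)^\lambda$ by $u\,\tfrac{d}{dz}+\lambda u'$ with $u=-(b+2az-cz^2)$), and let $J^\lambda=\operatorname{Ker}\Phi^\lambda$. Then for every $\lambda\in\mathbb C$ there is exactly one $G$-equivariant graded star product $\star_\lambda$ on $\mathcal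 R$ that corresponds to $J^\lambda$. Every $G$-equivariant graded star product on $\mathcal R$ is equal to $\star_\lambda$ for some $\lambda\in\mathbb C$. For $\lambda,\mu\in\mathbb C$, $\star_\lambda=\star_\mu$ if and only if $\mu=\lambda$ or $\mu=1-\lambda$, i.e. $\mu=\pm(\lambda-\tfrac12)+\tfrac12$. -/

import Mathlib

open scoped Polynomial LaurentPolynomial

noncomputable section

namespace SlTwo

/-- The Lie algebra `𝔤 = 𝔰𝔩(2, ℂ)` of traceless matrices. -/
abbrev g : Type := LieAlgebra.SpecialLinear.sl (Fin 2) ℂ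

/-- The enveloping algebra of `𝔤`. -/
abbrev U : Type := UniversalEnvelopingAlgebra ℂ g

/-- The symmetric algebra of `𝔤`, i.e. the algebra of polynomial functions on `𝔤*`. -/
abbrev S : Type := SymmetricAlgebra ℂ g

/-! ### The Poisson bracket of `S(𝔤)` -/

/-- The algebra homomorphism `a ↦ a + D a ε` from `S(𝔤)` to its dual numbers, where `D` is the
derivation that extends `φ`. -/
def symDerHom (φ : g →ₗ[ℂ] S) : S →ₐ[ℂ] TrivSqZeroExt S S :=
  SymmetricAlgebra.lift
    ((TrivSqZeroExt.inlAlgHom ℂ S S).toLinearMap ∘ₗ SymmetricAlgebra.ι ℂ g +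
      ((TrivSqZeroExt.inrHom S S).restrictScalars ℂ) ∘ₗ φ)

theorem symDerHom_fst (φ : g →ₗ[ℂ] S) (a : S) : (symDerHom φ a).fst = a := by
  have h : (TrivSqZeroExt.fstHom ℂ S S).comp (symDerHom φ) = AlgHom.id ℂ S := by
    apply SymmetricAlgebra.algHom_ext
    ext x
    simp [symDerHom]
  exact DFunLike.congr_fun h a

/-- The derivation of `S(𝔤)` that extends the linear map `φ : 𝔤 → S(𝔤)`. -/
def symDer (φ : g →ₗ[ℂ] S) : Derivation ℂ S S :=
  Derivation.mk' (((TrivSqZeroExt.sndHom S S).restrictScalars ℂ) ∘ₗ (symDerHom φ).toLinearMap)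
    (fun a b => by
      simp [symDerHom_fst, mul_comm])

theorem symDer_ι (φ : g →ₗ[ℂ] S) (x : g) : symDer φ (SymmetricAlgebra.ι ℂ g x) = φ x := by
  simp [symDer, symDerHom]

theorem derivation_ext {D₁ D₂ : Derivation ℂ S S}
    (h : ∀ x, D₁ (SymmetricAlgebra.ι ℂ g x) = D₂ (SymmetricAlgebra.ι ℂ g x)) : D₁ = D₂ := by
  ext a
  induction a using SymmetricAlgebra.induction with
  | algebraMap r => simp
  | ι x => exact h x
  | mul a b ha hb => simp [ha, hb]
  | add a b ha hb => simp [ha, hb]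

/-- For `b` in `S(𝔤)`, the linear map `x ↦ {x, b}` on `𝔤`, where `{x, ·}` is the derivation of
`S(𝔤)` with `{x, y} = [x, y]` for `y` in `𝔤`. -/
def adMap (b : S) : g →ₗ[ℂ] S where
  toFun x := symDer (SymmetricAlgebra.ι ℂ g ∘ₗ (LieAlgebra.ad ℂ g x : g →ₗ[ℂ] g)) b
  map_add' x y := by
    rw [← Derivation.add_apply]
    congr 1
    apply derivation_ext
    intro z
    simp [symDer_ι]
  map_smul' c x := by
    rw [RingHom.id_apply, ← Derivation.smul_apply]
    congr 1
    apply derivation_ext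
    intro z
    simp [symDer_ι]

/-- The Poisson bracket `{a, b}` of `S(𝔤)`: the biderivation with `{x, y} = [x, y]` for `x, y`
in `𝔤`. -/
def poisson (a b : S) : S := symDer (adMap b) a

/-! ### The minimal nilpotent orbit and its coordinate ring -/

/-- The highest root vector of `𝔤`. -/
def e : g := LieAlgebra.SpecialLinear.single 0 1 (by decide) 1

/-- The minimal nilpotent coadjoint orbit in `𝔤*`: the image of the adjoint `SL(2, ℂ)`-orbit of
the highest root vector under the isomorphism of `𝔤` with `𝔤*` given by the Killing form. -/
def Omin : Set (Module.Dual ℂ g) :=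
  {ξ | ∃ (γ : Matrix.SpecialLinearGroup (Fin 2) ℂ) (y : g),
    (y : Matrix (Fin 2) (Fin 2) ℂ) =
      (γ : Matrix (Fin 2) (Fin 2) ℂ) * (e : Matrix (Fin 2) (Fin 2) ℂ) *
        ((γ⁻¹ : Matrix.SpecialLinearGroup (Fin 2) ℂ) : Matrix (Fin 2) (Fin 2) ℂ) ∧
    ξ = killingForm ℂ g y}

/-- The ideal of the polynomial functions on `𝔤*` that vanish on the minimal orbit; the value of
`a` at `ξ` is `SymmetricAlgebra.lift ξ a`. -/
def I : Ideal S where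
  carrier := {a | ∀ ξ ∈ Omin, SymmetricAlgebra.lift ξ a = 0}
  add_mem' ha hb ξ hξ := by rw [map_add, ha ξ hξ, hb ξ hξ, add_zero]
  zero_mem' ξ _ := map_zero _
  smul_mem' c a ha ξ hξ := by rw [smul_eq_mul, map_mul, ha ξ hξ, mul_zero]

/-- The algebra of polynomial functions on the closure of the minimal orbit. -/
def R : Type := S ⧸ I

instance : CommRing R := inferInstanceAs (CommRing (S ⧸ I))

instance : Algebra ℂ R := inferInstanceAs (Algebra ℂ (S ⧸ I))

/-- The projection `S(𝔤) → R`. -/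
def proj : S →ₐ[ℂ] R := Ideal.Quotient.mkₐ ℂ I

/-- The momentum functions `μ_x`. -/
def mom : g →ₗ[ℂ] R := proj.toLinearMap ∘ₗ SymmetricAlgebra.ι ℂ g

/-- The graded piece `R^d`, the image of `S^d(𝔤)`: the span of the `d`-fold products of momentum
functions. It is zero for `d < 0`. -/
def Rgr (d : ℤ) : Submodule ℂ R :=
  if 0 ≤ d then (LinearMap.range mom) ^ d.toNat else ⊥

/-! ### Star products -/

/-- A graded star product on `R`: an associative `ℂ[t]`-bilinear product on `R[t]` such that, with
`f ⋆ h = ∑ C_p(f, h) t^p` for `f, h` in `R`, the four axioms below hold. The Poisson bracket of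
`R` is the one induced by that of `S(𝔤)`, so `{f, h}` is written with representatives. -/
@[ext]
structure StarProduct where
  /-- The product on `R[t]`. -/
  star : R[X] →ₗ[ℂ] R[X] →ₗ[ℂ] R[X]
  X_star : ∀ F G : R[X], star (Polynomial.X * F) G = Polynomial.X * star F G
  star_X : ∀ F G : R[X], star F (Polynomial.X * G) = Polynomial.X * star F G
  assoc : ∀ F G H : R[X], star (star F G) H = star F (star G H)
  /-- `C_0(f, h) = f h` -/
  coeff_zero : ∀ f h : R, (star (Polynomial.C f) (Polynomial.C h)).coeff 0 = f * h
  /-- `C_1(f, h) - C_1(h, f) = {f, h}` -/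
  coeff_one : ∀ a b : S,
    (star (Polynomial.C (proj a)) (Polynomial.C (proj b))).coeff 1 -
      (star (Polynomial.C (proj b)) (Polynomial.C (proj a))).coeff 1 = proj (poisson a b)
  /-- `C_p(f, h) = (-1)^p C_p(h, f)` -/
  parity : ∀ (p : ℕ) (f h : R),
    (star (Polynomial.C f) (Polynomial.C h)).coeff p =
      (-1) ^ p * (star (Polynomial.C h) (Polynomial.C f)).coeff p
  /-- `C_p(R^k, R^l) ⊆ R^(k + l - p)` -/
  graded : ∀ (p k l : ℕ), ∀ f ∈ Rgr k, ∀ h ∈ Rgr l,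
    (star (Polynomial.C f) (Polynomial.C h)).coeff p ∈ Rgr ((k : ℤ) + l - p)

namespace StarProduct

/-- `G`-equivariance (strong `𝔤`-invariance): `μ_x ⋆ f - f ⋆ μ_x = t {μ_x, f}`. -/
def IsEquivariant (s : StarProduct) : Prop :=
  ∀ (x : g) (a : S),
    s.star (Polynomial.C (mom x)) (Polynomial.C (proj a)) -
        s.star (Polynomial.C (proj a)) (Polynomial.C (mom x)) =
      Polynomial.X * Polynomial.C (proj (poisson (SymmetricAlgebra.ι ℂ g x) a))

/-- The product `f ∘ h` on `R`, the value of `f ⋆ h` at `t = 1`. -/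
def circ (s : StarProduct) (f h : R) : R :=
  (s.star (Polynomial.C f) (Polynomial.C h)).eval 1

/-- The star product `s` corresponds to the ideal `J` of `U(𝔤)` if `J` is the kernel of the algebra
homomorphism `Ψ : U(𝔤) → (R, ∘)` with `Ψ x = μ_x` for `x` in `𝔤`, in other words
`Ψ (x₁ ⋯ x_d) = μ_{x₁} ∘ ⋯ ∘ μ_{x_d}`. -/
def CorrespondsTo (s : StarProduct) (J : Ideal U) : Prop :=
  ∃ Ψ : U →ₗ[ℂ] R,
    Ψ 1 = 1 ∧ (∀ u v, Ψ (u * v) = s.circ (Ψ u) (Ψ v)) ∧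
      (∀ x : g, Ψ (UniversalEnvelopingAlgebra.ι ℂ x) = mom x) ∧
      ∀ u, u ∈ J ↔ Ψ u = 0

end StarProduct

/-! ### Twisted differential operators on the projective line

On `ℙ¹` we use the coordinate `z` on the big cell, `w = 1/z` on the other standard chart, and on the
intersection of the charts we identify a local section `f (dz)^l` of the `l`-th power of the
canonical bundle with the Laurent polynomial `f` in `z = T 1`. -/

/-- `d/dz` as a linear map on Laurent polynomials, `z^n ↦ n z^(n-1)`. -/
def ddzLin : ℂ[T;T⁻¹] →ₗ[ℂ] ℂ[T;T⁻¹] :=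
  Finsupp.lsum ℂ
      (fun n : ℤ => LinearMap.toSpanSingleton ℂ ℂ[T;T⁻¹] ((n : ℂ) • LaurentPolynomial.T (n - 1))) ∘ₗ
    (AddMonoidAlgebra.coeffLinearEquiv ℂ).toLinearMap

theorem ddzLin_C_mul_T (n : ℤ) (c : ℂ) :
    ddzLin (LaurentPolynomial.C c * LaurentPolynomial.T n) =
      LaurentPolynomial.C (c * n) * LaurentPolynomial.T (n - 1) := by
  rw [← LaurentPolynomial.single_eq_C_mul_T, map_mul, mul_assoc,
    ← LaurentPolynomial.smul_eq_C_mul, ← LaurentPolynomial.smul_eq_C_mul]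
  change Finsupp.lsum ℂ _ (Finsupp.single n c) = _
  rw [Finsupp.lsum_single, LinearMap.toSpanSingleton_apply]

theorem ddzLin_mul (f h : ℂ[T;T⁻¹]) : ddzLin (f * h) = f • ddzLin h + h • ddzLin f := by
  induction f using LaurentPolynomial.induction_on' with
  | add p q hp hq => simp only [add_mul, map_add, hp, hq, add_smul, smul_add]; abel
  | C_mul_T n a =>
    induction h using LaurentPolynomial.induction_on' with
    | add p q hp hq => simp only [mul_add, map_add, hp, hq, add_smul, smul_add]; abel
    | C_mul_T m b =>
      have h1 : LaurentPolynomial.C a * LaurentPolynomial.T n *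
          (LaurentPolynomial.C b * LaurentPolynomial.T m) =
          LaurentPolynomial.C (a * b) * LaurentPolynomial.T (n + m) := by
        rw [map_mul, LaurentPolynomial.T_add]; ring
      rw [h1, ddzLin_C_mul_T, ddzLin_C_mul_T, ddzLin_C_mul_T]
      simp only [smul_eq_mul, map_mul, Int.cast_add, map_add, LaurentPolynomial.T_add,
        LaurentPolynomial.T_sub]
      ring

/-- The derivation `d/dz` of the algebra of Laurent polynomials. -/
def ddz : Derivation ℂ ℂ[T;T⁻¹] ℂ[T;T⁻¹] := Derivation.mk' ddzLin ddzLin_mul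

theorem ddz_T (n : ℤ) :
    ddz (LaurentPolynomial.T n) = LaurentPolynomial.C (n : ℂ) * LaurentPolynomial.T (n - 1) := by
  have h := ddzLin_C_mul_T n 1
  rw [map_one, one_mul, one_mul] at h
  exact h

/-- Linear operators on the sections over the intersection of the charts. -/
abbrev Op : Type := Module.End ℂ ℂ[T;T⁻¹]

/-- Multiplication by `z^n`. -/
def mulT (n : ℤ) : Op := LinearMap.mulLeft ℂ (LaurentPolynomial.T n)

/-- The operator `d/dw` in the trivialization `(dw)^l`, written in the trivialization `(dz)^l`.
As `(dz)^l = const · w^(-2l) (dw)^l`, it is the conjugate `w^(2l) (d/dw) w^(-2l)`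
`= d/dw - 2l w⁻¹ = -z² d/dz - 2l z`. -/
def ddw (l : ℂ) : Op := -(mulT 2 * (ddz : Op)) - (2 * l) • mulT 1

/-- The twisted differential operators over the chart with coordinate `z`: the algebra generated
by `z` and `d/dz`. -/
def chartZ : Subalgebra ℂ Op := Algebra.adjoin ℂ {mulT 1, (ddz : Op)}

/-- The twisted differential operators over the chart with coordinate `w`: the algebra generated
by `w` and `d/dw`, the latter acting on coefficients of `(dw)^l`. -/
def chartW (l : ℂ) : Subalgebra ℂ Op := Algebra.adjoin ℂ {mulT (-1), ddw l}

/-- The algebra of global sections of the sheaf of twisted differential operators acting on local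
sections of the `l`-th power of the canonical bundle of `ℙ¹`: the operators over the
intersection of the two charts that extend to both charts. -/
def twistedDiffOp (l : ℂ) : Subalgebra ℂ Op := chartZ ⊓ chartW l

/-- The coefficient of the vector field `u d/dz` through which `x` acts on functions on `ℙ¹`: for
`x = (a b; c -a)`, the derivative at `t = 0` of `f(exp(-t x) • z)`, with `•` the action by Möbius
transformations, is `u f'` where `u = -(b + 2 a z - c z²)`. -/
def vf (x : g) : ℂ[T;T⁻¹] :=
  -(LaurentPolynomial.C ((x : Matrix (Fin 2) (Fin 2) ℂ) 0 1) +
    LaurentPolynomial.C (2 * (x : Matrix (Fin 2) (Fin 2) ℂ) 0 0) * LaurentPolynomial.T 1 -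
    LaurentPolynomial.C ((x : Matrix (Fin 2) (Fin 2) ℂ) 1 0) * LaurentPolynomial.T 2)

/-- The twisted vector field of `x`, i.e. the Lie derivative
`f (dz)^l ↦ (u f' + l u' f) (dz)^l` along the vector field `u d/dz` of `x`. -/
def twistedVF (l : ℂ) (x : g) : Op :=
  LinearMap.mulLeft ℂ (vf x) * (ddz : Op) + l • LinearMap.mulLeft ℂ (ddz (vf x))

theorem C_two : (LaurentPolynomial.C 2 : ℂ[T;T⁻¹]) = 2 := map_ofNat _ 2

theorem vf_add (x y : g) : vf (x + y) = vf x + vf y := by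
  have h (i j : Fin 2) : ((x + y : g) : Matrix (Fin 2) (Fin 2) ℂ) i j =
      (x : Matrix (Fin 2) (Fin 2) ℂ) i j + (y : Matrix (Fin 2) (Fin 2) ℂ) i j := rfl
  simp only [vf, h, mul_add, map_add]
  ring

theorem vf_smul (c : ℂ) (x : g) : vf (c • x) = c • vf x := by
  have h (i j : Fin 2) : ((c • x : g) : Matrix (Fin 2) (Fin 2) ℂ) i j =
      c * (x : Matrix (Fin 2) (Fin 2) ℂ) i j := rfl
  simp only [vf, h, map_mul, LaurentPolynomial.smul_eq_C_mul]
  ring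

theorem trace_entry (x : g) :
    (x : Matrix (Fin 2) (Fin 2) ℂ) 1 1 = -(x : Matrix (Fin 2) (Fin 2) ℂ) 0 0 := by
  have h : Matrix.trace (x : Matrix (Fin 2) (Fin 2) ℂ) = 0 :=
    (LinearMap.mem_ker).1 x.2
  rw [Matrix.trace_fin_two] at h
  linear_combination h

theorem ddz_vf (x : g) :
    ddz (vf x) = -(LaurentPolynomial.C (2 * (x : Matrix (Fin 2) (Fin 2) ℂ) 0 0) -
      LaurentPolynomial.C (2 * (x : Matrix (Fin 2) (Fin 2) ℂ) 1 0) * LaurentPolynomial.T 1) := by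
  simp only [vf, LaurentPolynomial.C_eq_algebraMap, map_neg, map_sub, map_add,
    Derivation.leibniz, Derivation.map_algebraMap, ddz_T, smul_eq_mul]
  norm_num
  ring

theorem vf_lie (x y : g) : vf ⁅x, y⁆ = vf x * ddz (vf y) - vf y * ddz (vf x) := by
  have hT : (LaurentPolynomial.T 2 : ℂ[T;T⁻¹]) =
      LaurentPolynomial.T 1 * LaurentPolynomial.T 1 := by
    rw [← LaurentPolynomial.T_add]; norm_num
  rw [ddz_vf, ddz_vf]
  simp only [vf, LieAlgebra.SpecialLinear.sl_bracket, Matrix.sub_apply, Matrix.mul_apply,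
    Fin.sum_univ_two, trace_entry, map_mul, map_sub, map_add, map_neg, hT, C_two]
  ring

theorem twistedVF_mem (l : ℂ) (x : g) : twistedVF l x ∈ twistedDiffOp l := by
  have h0 : twistedVF l x =
      -((x : Matrix (Fin 2) (Fin 2) ℂ) 0 1 • (ddz : Op)
        + (2 * (x : Matrix (Fin 2) (Fin 2) ℂ) 0 0) • (mulT 1 * (ddz : Op))
        - (x : Matrix (Fin 2) (Fin 2) ℂ) 1 0 • (mulT 1 * (mulT 1 * (ddz : Op)))
        + (2 * l * (x : Matrix (Fin 2) (Fin 2) ℂ) 0 0) • 1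
        - (2 * l * (x : Matrix (Fin 2) (Fin 2) ℂ) 1 0) • mulT 1) := by
    have hT : (LaurentPolynomial.T 2 : ℂ[T;T⁻¹]) =
        LaurentPolynomial.T 1 * LaurentPolynomial.T 1 := by
      rw [← LaurentPolynomial.T_add]; norm_num
    apply LinearMap.ext
    intro f
    rw [twistedVF, ddz_vf]
    simp only [mulT, vf, LinearMap.add_apply, LinearMap.sub_apply,
      LinearMap.neg_apply, LinearMap.smul_apply, Module.End.mul_apply, LinearMap.mulLeft_apply,
      Module.End.one_apply, LaurentPolynomial.smul_eq_C_mul, map_mul, hT]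
    ring
  have h1 : twistedVF l x =
      (x : Matrix (Fin 2) (Fin 2) ℂ) 0 1 •
          (mulT (-1) * (mulT (-1) * ddw l) + (2 * l) • mulT (-1))
        + (x : Matrix (Fin 2) (Fin 2) ℂ) 0 0 • ((2 : ℂ) • (mulT (-1) * ddw l) + (2 * l) • 1)
        - (x : Matrix (Fin 2) (Fin 2) ℂ) 1 0 • ddw l := by
    have hT : (LaurentPolynomial.T 2 : ℂ[T;T⁻¹]) =
        LaurentPolynomial.T 1 * LaurentPolynomial.T 1 := by
      rw [← LaurentPolynomial.T_add]; norm_num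
    have hT' : (LaurentPolynomial.T 1 : ℂ[T;T⁻¹]) * LaurentPolynomial.T (-1) = 1 := by
      rw [← LaurentPolynomial.T_add]; norm_num
    apply LinearMap.ext
    intro f
    rw [twistedVF, ddz_vf]
    simp only [mulT, ddw, vf, LinearMap.add_apply, LinearMap.sub_apply,
      LinearMap.neg_apply, LinearMap.smul_apply, Module.End.mul_apply, LinearMap.mulLeft_apply,
      Module.End.one_apply, LaurentPolynomial.smul_eq_C_mul, map_mul, hT, map_ofNat]
    linear_combination
      (2 * LaurentPolynomial.C ((x : Matrix (Fin 2) (Fin 2) ℂ) 0 1) * LaurentPolynomial.C l * f *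
          LaurentPolynomial.T (-1) +
        LaurentPolynomial.C ((x : Matrix (Fin 2) (Fin 2) ℂ) 0 1) * (ddz : Op) f *
          (LaurentPolynomial.T 1 * LaurentPolynomial.T (-1) + 1) +
        2 * LaurentPolynomial.C ((x : Matrix (Fin 2) (Fin 2) ℂ) 0 0) * LaurentPolynomial.T 1 *
          (ddz : Op) f +
        4 * LaurentPolynomial.C ((x : Matrix (Fin 2) (Fin 2) ℂ) 0 0) * LaurentPolynomial.C l * f) *
      hT'
  rw [twistedDiffOp, Algebra.mem_inf]
  have hz : mulT 1 ∈ chartZ := Algebra.subset_adjoin (by simp)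
  have hdz : (ddz : Op) ∈ chartZ := Algebra.subset_adjoin (by simp)
  have hw : mulT (-1) ∈ chartW l := Algebra.subset_adjoin (by simp)
  have hdw : ddw l ∈ chartW l := Algebra.subset_adjoin (by simp)
  constructor
  · rw [h0]
    exact neg_mem (sub_mem (add_mem (sub_mem (add_mem (Subalgebra.smul_mem _ hdz _)
      (Subalgebra.smul_mem _ (mul_mem hz hdz) _))
      (Subalgebra.smul_mem _ (mul_mem hz (mul_mem hz hdz)) _))
      (Subalgebra.smul_mem _ (one_mem _) _)) (Subalgebra.smul_mem _ hz _))
  · rw [h1]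
    exact sub_mem (add_mem (Subalgebra.smul_mem _ (add_mem (mul_mem hw (mul_mem hw hdw))
      (Subalgebra.smul_mem _ hw _)) _) (Subalgebra.smul_mem _ (add_mem
      (Subalgebra.smul_mem _ (mul_mem hw hdw) _) (Subalgebra.smul_mem _ (one_mem _) _)) _))
      (Subalgebra.smul_mem _ hdw _)

theorem twistedVF_lie (l : ℂ) (x y : g) :
    twistedVF l ⁅x, y⁆ = twistedVF l x * twistedVF l y - twistedVF l y * twistedVF l x := by
  apply LinearMap.ext
  intro f
  simp only [twistedVF, vf_lie, LinearMap.add_apply, LinearMap.sub_apply, LinearMap.smul_apply,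
    Module.End.mul_apply, LinearMap.mulLeft_apply, LaurentPolynomial.smul_eq_C_mul,
    Derivation.coeFn_coe, map_sub, map_add, Derivation.leibniz, smul_eq_mul,
    LaurentPolynomial.C_eq_algebraMap, Derivation.map_algebraMap]
  ring

attribute [local instance] LieRing.ofAssociativeRing LieAlgebra.ofAssociativeAlgebra

/-- The Lie algebra homomorphism `x ↦ Φ^l_x`, the infinitesimal action of `𝔤` on local sections of
the `l`-th power of the canonical bundle. -/
def phiLie (l : ℂ) : g →ₗ⁅ℂ⁆ twistedDiffOp l where
  toFun x := ⟨twistedVF l x, twistedVF_mem l x⟩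
  map_add' x y := by
    apply Subtype.ext
    apply LinearMap.ext
    intro f
    simp [twistedVF, vf_add, add_mul]
    ring
  map_smul' c x := by
    apply Subtype.ext
    apply LinearMap.ext
    intro f
    have h : ddz (LaurentPolynomial.C c * vf x) = LaurentPolynomial.C c * ddz (vf x) := by
      rw [← LaurentPolynomial.smul_eq_C_mul, ← LaurentPolynomial.smul_eq_C_mul]
      exact ddz.map_smul c (vf x)
    simp only [twistedVF, vf_smul, LinearMap.add_apply, LinearMap.smul_apply,
      Module.End.mul_apply, LinearMap.mulLeft_apply, RingHom.id_apply, SetLike.val_smul,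
      LaurentPolynomial.smul_eq_C_mul, h]
    ring
  map_lie' {x y} := by
    apply Subtype.ext
    exact twistedVF_lie l x y

/-- The algebra homomorphism `Φ^l` from `U(𝔤)` to the algebra of global twisted differential
operators on `ℙ¹`. -/
def Phi (l : ℂ) : U →ₐ[ℂ] twistedDiffOp l := UniversalEnvelopingAlgebra.lift ℂ (phiLie l)

/-- The two-sided ideal `J^l = Ker Φ^l` of `U(𝔤)`. -/
def J (l : ℂ) : Ideal U := RingHom.ker (Phi l)

end SlTwo

end

/-!
The orbit closure is the quotient of the plane by `±1`, so `R` is the algebra of even polynomials in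
`u, v`, and its Poisson bracket comes from the canonical bracket of the plane.

Existence. For each `τ`, left multiplication by `μ_x` is taken to be
`μ_x + (t / 2) {μ_x, ·} + t² D_x`, where `D_x` is a second order operator with constant coefficients
followed by a scalar depending on the degree and on `τ`. The scalars solve the recursion which makes
these operators commute with the ones obtained from them by `t ↦ -t`. The two commuting algebras of
operators have `1` as a cyclic vector, hence are the left and right multiplications of an
associative product on `R[t]`.

Uniqueness. The highest weight vectors of `R` are the powers of `μ_e`, which `Ψ` assigns to the
powers of `e`; so `Ψ` is onto, and `⋆` can be recovered from `Ψ`. Modulo the Casimir element, `U` is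
spanned by the ordered monomials at most linear in `h`, whose images under `Ψ` have distinct leading
monomials. Hence the value of `Ψ` at the Casimir element determines the kernel of `Ψ`, and with it
`⋆`.

Comparison. `Φ^l` maps the Casimir element to `4 l (l - 1)`, so `⋆` corresponds to `J^l` if and only
if its Casimir value is `4 l (l - 1)`; this number is invariant exactly under `l ↦ 1 - l`.
-/

open scoped Polynomial LaurentPolynomial

noncomputable section

namespace SlTwo

attribute [local instance] LieRing.ofAssociativeRing LieAlgebra.ofAssociativeAlgebra

/-! ### Products defined by commuting cyclic algebras of operators -/

section CyclicPair

variable {K V : Type*} [CommRing K] [AddCommGroup V] [Module K V]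
  {A B : Subalgebra K (Module.End K V)} {v : V}

theorem conjAlgEquiv_apply_of_apply_eq {σ : V ≃ₗ[K] V} (hσ : σ v = v) (a : Module.End K V) :
    σ.conjAlgEquiv K a v = σ (a v) := by
  rw [LinearEquiv.conjAlgEquiv_apply_apply, (LinearEquiv.symm_apply_eq σ).2 hσ.symm]

/-- Two commuting algebras of operators for which `v` is a cyclic vector. Such a pair makes `V` into
an associative algebra with unit `v` whose left and right multiplications are `A` and `B`. -/
structure IsCyclicPair (A B : Subalgebra K (Module.End K V)) (v : V) : Prop where
  commute : ∀ a ∈ A, ∀ b ∈ B, Commute a b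
  exists_left : ∀ w, ∃ a ∈ A, a v = w
  exists_right : ∀ w, ∃ b ∈ B, b v = w

namespace IsCyclicPair

theorem ext_left (hAB : IsCyclicPair A B v) {a a' : Module.End K V} (ha : a ∈ A) (ha' : a' ∈ A)
    (hv : a v = a' v) : a = a' := by
  ext w
  obtain ⟨b, hb, rfl⟩ := hAB.exists_right w
  calc a (b v) = b (a v) := DFunLike.congr_fun (hAB.commute a ha b hb).eq v
    _ = b (a' v) := by rw [hv]
    _ = a' (b v) := (DFunLike.congr_fun (hAB.commute a' ha' b hb).eq v).symm

/-- The product `w * w' = a w'`, where `a` is the element of `A` with `a v = w`. -/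
def mul (hAB : IsCyclicPair A B v) : V →ₗ[K] V →ₗ[K] V where
  toFun w := (hAB.exists_left w).choose
  map_add' w w' := by
    have hw := (hAB.exists_left w).choose_spec
    have hw' := (hAB.exists_left w').choose_spec
    have hs := (hAB.exists_left (w + w')).choose_spec
    exact hAB.ext_left hs.1 (add_mem hw.1 hw'.1) (by rw [hs.2, LinearMap.add_apply, hw.2, hw'.2])
  map_smul' c w := by
    have hw := (hAB.exists_left w).choose_spec
    have hs := (hAB.exists_left (c • w)).choose_spec
    exact hAB.ext_left hs.1 (A.smul_mem hw.1 c)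
      (by rw [hs.2, RingHom.id_apply, LinearMap.smul_apply, hw.2])

theorem mul_left (hAB : IsCyclicPair A B v) {a : Module.End K V} (ha : a ∈ A) :
    hAB.mul (a v) = a :=
  have hs := (hAB.exists_left (a v)).choose_spec
  hAB.ext_left hs.1 ha hs.2

theorem mul_apply_left (hAB : IsCyclicPair A B v) {a : Module.End K V} (ha : a ∈ A) (w w' : V) :
    hAB.mul (a w) w' = a (hAB.mul w w') := by
  obtain ⟨a', ha', rfl⟩ := hAB.exists_left w
  rw [← Module.End.mul_apply, hAB.mul_left (mul_mem ha ha'), hAB.mul_left ha',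
    Module.End.mul_apply]

theorem mul_apply_right (hAB : IsCyclicPair A B v) {b : Module.End K V} (hb : b ∈ B) (w w' : V) :
    hAB.mul w (b w') = b (hAB.mul w w') := by
  obtain ⟨a, ha, rfl⟩ := hAB.exists_left w
  rw [hAB.mul_left ha]
  exact DFunLike.congr_fun (hAB.commute a ha b hb).eq w'

theorem mul_right (hAB : IsCyclicPair A B v) {b : Module.End K V} (hb : b ∈ B) (w : V) :
    hAB.mul w (b v) = b w := by
  obtain ⟨a, ha, rfl⟩ := hAB.exists_left w
  rw [hAB.mul_apply_right hb, hAB.mul_left ha]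

theorem mul_assoc (hAB : IsCyclicPair A B v) (w₁ w₂ w₃ : V) :
    hAB.mul (hAB.mul w₁ w₂) w₃ = hAB.mul w₁ (hAB.mul w₂ w₃) := by
  obtain ⟨a, ha, rfl⟩ := hAB.exists_left w₁
  rw [hAB.mul_left ha, hAB.mul_apply_left ha]

theorem mul_equiv (hAB : IsCyclicPair A B v) (σ : V ≃ₗ[K] V) (hσ : σ v = v)
    (hconj : ∀ a ∈ A, σ.conjAlgEquiv K a ∈ B) (w w' : V) :
    hAB.mul (σ w) (σ w') = σ (hAB.mul w' w) := by
  obtain ⟨a, ha, rfl⟩ := hAB.exists_left w'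
  rw [← conjAlgEquiv_apply_of_apply_eq hσ, hAB.mul_right (hconj a ha), hAB.mul_left ha,
    LinearEquiv.conjAlgEquiv_apply_apply, σ.symm_apply_apply]

end IsCyclicPair

end CyclicPair

/-! ### Operators on `A[t]` -/

section PolynomialOperators

variable {K A : Type*} [CommRing K] [CommRing A] [Algebra K A]

/-- The action of an operator on `A` on the coefficients of the polynomials in `A[t]`. -/
def mapCoeff (T : Module.End K A) : Module.End K A[X] :=
  Polynomial.lsum fun n => ((Polynomial.monomial n).restrictScalars K) ∘ₗ T

theorem mapCoeff_monomial (T : Module.End K A) (n : ℕ) (r : A) :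
    mapCoeff T (Polynomial.monomial n r) = Polynomial.monomial n (T r) := by
  simp [mapCoeff, Polynomial.lsum_apply, Polynomial.sum_monomial_index]

@[simp] theorem coeff_mapCoeff (T : Module.End K A) (F : A[X]) (n : ℕ) :
    (mapCoeff T F).coeff n = T (F.coeff n) := by
  induction F using Polynomial.induction_on' with
  | add F G hF hG => simp only [map_add, Polynomial.coeff_add, hF, hG]
  | monomial m r =>
    rw [mapCoeff_monomial, Polynomial.coeff_monomial, Polynomial.coeff_monomial, apply_ite T,
      map_zero]

/-- The `t`-linear extension to `A[t]` of the operators on `A`. -/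
def extend : Module.End K A →ₐ[K] Module.End K A[X] :=
  AlgHom.ofLinearMap
    { toFun := mapCoeff
      map_add' T T' := by ext F n : 2; simp
      map_smul' c T := by ext F n : 2; simp }
    (by ext F n : 2; simp) (fun T T' => by ext F n : 2; simp)

@[simp] theorem coeff_extend (T : Module.End K A) (F : A[X]) (n : ℕ) :
    (extend T F).coeff n = T (F.coeff n) := coeff_mapCoeff T F n

theorem extend_C (T : Module.End K A) (r : A) :
    extend T (Polynomial.C r) = Polynomial.C (T r) := mapCoeff_monomial T 0 r

/-- Multiplication by `t` on `A[t]`. -/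
def mulX : Module.End K A[X] := LinearMap.mulLeft K Polynomial.X

@[simp] theorem mulX_apply (F : A[X]) : (mulX : Module.End K A[X]) F = Polynomial.X * F := rfl

theorem mulX_commute_extend (T : Module.End K A) : Commute mulX (extend T) := by
  ext F n : 2
  cases n <;> simp

/-- The automorphism `t ↦ -t` of `A[t]`. -/
def flip : A[X] ≃ₗ[K] A[X] := Polynomial.algEquivAevalNegX.toLinearEquiv.restrictScalars K

@[simp] theorem coeff_flip (F : A[X]) (n : ℕ) :
    (flip (K := K) F).coeff n = (-1 : K) ^ n • F.coeff n := by
  have h : flip (K := K) F = F.comp (Polynomial.C (-1) * Polynomial.X) := by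
    rw [map_neg, map_one, neg_one_mul]
    rfl
  rw [h, Polynomial.comp_C_mul_X_coeff, mul_comm, Algebra.smul_def, map_pow, map_neg, map_one]

theorem flip_C (r : A) : flip (K := K) (Polynomial.C r) = Polynomial.C r := by
  ext n
  cases n <;> simp [Polynomial.coeff_C]

theorem conj_flip_mulX : flip.conjAlgEquiv K (mulX : Module.End K A[X]) = (-1 : K) • mulX := by
  ext F n : 2
  obtain ⟨F, rfl⟩ := flip (K := K).surjective F
  cases n <;> simp [pow_succ]

theorem conj_flip_extend (T : Module.End K A) : flip.conjAlgEquiv K (extend T) = extend T := by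
  ext F n : 2
  obtain ⟨F, rfl⟩ := flip (K := K).surjective F
  simp

/-- The operator `a + t b + t² c` on `A[t]`. -/
def extendQuadratic (a b c : Module.End K A) : Module.End K A[X] :=
  extend a + mulX * extend b + mulX * (mulX * extend c)

theorem extendQuadratic_C (a b c : Module.End K A) (r : A) :
    extendQuadratic a b c (Polynomial.C r) =
      Polynomial.C (a r) + Polynomial.X * Polynomial.C (b r) +
        Polynomial.X * (Polynomial.X * Polynomial.C (c r)) := by
  simp only [extendQuadratic, LinearMap.add_apply, Module.End.mul_apply, extend_C, mulX_apply]

theorem extendQuadratic_sub (a b b' c : Module.End K A) :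
    extendQuadratic a b c - extendQuadratic a b' c = mulX * extend (b - b') := by
  rw [extendQuadratic, extendQuadratic, add_sub_add_right_eq_sub, add_sub_add_left_eq_sub, map_sub,
    mul_sub]

theorem mulX_commute_extendQuadratic (a b c : Module.End K A) :
    Commute mulX (extendQuadratic a b c) :=
  ((mulX_commute_extend a).add_right ((Commute.refl _).mul_right (mulX_commute_extend b))).add_right
    ((Commute.refl _).mul_right ((Commute.refl _).mul_right (mulX_commute_extend c)))

theorem extendQuadratic_mul (a b c a' b' c' : Module.End K A) :
    extendQuadratic a b c * extendQuadratic a' b' c' =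
      extend (a * a') + mulX * extend (a * b' + b * a') +
      mulX * (mulX * extend (a * c' + b * b' + c * a')) +
      mulX * (mulX * (mulX * extend (b * c' + c * b'))) +
      mulX * (mulX * (mulX * (mulX * extend (c * c')))) := by
  have hX (T : Module.End K A) (T' : Module.End K A[X]) :
      extend T * (mulX * T') = mulX * (extend T * T') :=
    (mulX_commute_extend T).symm.left_comm T'
  simp only [extendQuadratic, map_add, map_mul, mul_add, add_mul, mul_assoc, hX]
  abel

theorem commute_extendQuadratic {a b c a' b' c' : Module.End K A} (h0 : a * a' = a' * a)
    (h1 : a * b' + b * a' = a' * b + b' * a)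
    (h2 : a * c' + b * b' + c * a' = a' * c + b' * b + c' * a)
    (h3 : b * c' + c * b' = b' * c + c' * b) (h4 : c * c' = c' * c) :
    Commute (extendQuadratic a b c) (extendQuadratic a' b' c') := by
  rw [commute_iff_eq, extendQuadratic_mul, extendQuadratic_mul, h0, h1, h2, h3, h4]

theorem conj_flip_extendQuadratic (a b c : Module.End K A) :
    flip.conjAlgEquiv K (extendQuadratic a b c) = extendQuadratic a ((-1 : K) • b) c := by
  simp only [extendQuadratic, map_add, map_mul, map_smul, conj_flip_mulX, conj_flip_extend,
    smul_mul_assoc, mul_smul_comm, smul_smul, neg_mul_neg, mul_one, one_smul]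

end PolynomialOperators

/-! ### Polynomials -/

section MvPolynomial

open MvPolynomial

variable {σ K : Type*}

theorem eq_zero_of_eval_eq_zero_of_ne_zero [CommRing K] [IsDomain K] [Infinite K] [Nonempty σ]
    {F : MvPolynomial σ K} (hF : ∀ p : σ → K, p ≠ 0 → eval p F = 0) : F = 0 := by
  obtain ⟨i⟩ := ‹Nonempty σ›
  have hXF : X i * F = 0 := by
    apply MvPolynomial.funext
    intro p
    by_cases hp : p = 0
    · simp [hp]
    · simp [hF p hp]
  exact (mul_eq_zero.1 hXF).resolve_left (X_ne_zero i)

theorem pderiv_pderiv_comm [CommRing K] (i j : σ) (F : MvPolynomial σ K) :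
    pderiv i (pderiv j F) = pderiv j (pderiv i F) := by
  induction F using MvPolynomial.induction_on with
  | C a => simp only [pderiv_C, map_zero]
  | add F G hF hG => simp only [map_add, hF, hG]
  | mul_X F k hF =>
    classical
    simp only [Derivation.leibniz, map_add, smul_eq_mul, hF, pderiv_X, Pi.single_apply,
      apply_ite (pderiv _), Derivation.map_one_eq_zero, map_zero, ite_self, mul_zero, zero_add]
    ring

theorem mem_of_monomial_mem [CommSemiring K] {N : Submodule K (MvPolynomial σ K)}
    {F : MvPolynomial σ K} (hF : ∀ m ∈ F.support, monomial m 1 ∈ N) : F ∈ N := by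
  rw [F.as_sum]
  refine sum_mem fun m hm => ?_
  rw [← mul_one (F.coeff m), ← smul_eq_mul, ← smul_monomial]
  exact N.smul_mem _ (hF m hm)

theorem monomial_one_fin_two [CommSemiring K] (m : Fin 2 →₀ ℕ) :
    (monomial m 1 : MvPolynomial (Fin 2) K) = X 0 ^ m 0 * X 1 ^ m 1 := by
  rw [monomial_eq, Finsupp.prod_fintype _ _ (fun i => pow_zero _), Fin.prod_univ_two, C_1, one_mul]

/-- The operator that multiplies the homogeneous polynomials of degree `n` by `c n`. -/
def scaleDegree [CommSemiring K] (c : ℕ → K) : MvPolynomial σ K →ₗ[K] MvPolynomial σ K :=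
  (basisMonomials σ K).constr K fun m => c m.degree • basisMonomials σ K m

theorem scaleDegree_of_isHomogeneous [CommSemiring K] (c : ℕ → K) {n : ℕ} {F : MvPolynomial σ K}
    (hF : F.IsHomogeneous n) : scaleDegree c F = c n • F := by
  have hmonomial (m : σ →₀ ℕ) : scaleDegree c (monomial m 1) = c m.degree • monomial m 1 :=
    (basisMonomials σ K).constr_basis K _ m
  rw [F.as_sum, map_sum, Finset.smul_sum]
  refine Finset.sum_congr rfl fun m hm => ?_
  rw [← mul_one (F.coeff m), ← smul_eq_mul, ← smul_monomial, map_smul, hmonomial, smul_comm,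
    Finsupp.degree_apply, ← hF.degree_eq_sum_deg_support hm]

end MvPolynomial

theorem iSup_pow_mul_iSup_pow_le {K A : Type*} [CommSemiring K] [Semiring A] [Algebra K A]
    (M : Submodule K A) : (⨆ k : ℕ, M ^ k) * (⨆ k : ℕ, M ^ k) ≤ ⨆ k : ℕ, M ^ k := by
  rw [Submodule.iSup_mul]
  refine iSup_le fun k => ?_
  rw [Submodule.mul_iSup]
  refine iSup_le fun l => ?_
  rw [← pow_add]
  exact le_iSup (fun k : ℕ => M ^ k) (k + l)

/-! ### Coordinates on `𝔤` -/

/-- The traceless matrix `(a b; c -a)`. -/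
def mk (a b c : ℂ) : g :=
  ⟨!![a, b; c, -a], LinearMap.mem_ker.2 (by simp [Matrix.trace_fin_two])⟩

/-- The coroot vector of `𝔤`. -/
def h : g := mk 1 0 0

/-- The lowest root vector of `𝔤`. -/
def f : g := mk 0 0 1

/-- The entry of a traceless matrix as a linear form. -/
def entry (i j : Fin 2) : g →ₗ[ℂ] ℂ where
  toFun x := (x : Matrix (Fin 2) (Fin 2) ℂ) i j
  map_add' _ _ := rfl
  map_smul' _ _ := rfl

theorem entry_one_one (x : g) : entry 1 1 x = -entry 0 0 x := trace_entry x

theorem ext_entry {x y : g} (h₀ : entry 0 0 x = entry 0 0 y) (h₁ : entry 0 1 x = entry 0 1 y)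
    (h₂ : entry 1 0 x = entry 1 0 y) : x = y := by
  ext i j
  fin_cases i <;> fin_cases j
  · exact h₀
  · exact h₁
  · exact h₂
  · exact (entry_one_one x).trans (h₀ ▸ (entry_one_one y).symm)

@[simp] theorem entry_mk_zero_zero (a b c : ℂ) : entry 0 0 (mk a b c) = a := rfl
@[simp] theorem entry_mk_zero_one (a b c : ℂ) : entry 0 1 (mk a b c) = b := rfl
@[simp] theorem entry_mk_one_zero (a b c : ℂ) : entry 1 0 (mk a b c) = c := rfl

theorem entry_lie (i j : Fin 2) (x y : g) : entry i j ⁅x, y⁆ =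
    entry i 0 x * entry 0 j y + entry i 1 x * entry 1 j y
      - (entry i 0 y * entry 0 j x + entry i 1 y * entry 1 j x) := by
  change (⁅x, y⁆ : g).val i j = _
  rw [LieAlgebra.SpecialLinear.sl_bracket, Matrix.sub_apply, Matrix.mul_apply, Matrix.mul_apply,
    Fin.sum_univ_two, Fin.sum_univ_two]
  rfl

theorem lie_eq_mk (x y : g) : ⁅x, y⁆ =
    mk (entry 0 1 x * entry 1 0 y - entry 1 0 x * entry 0 1 y)
      (2 * (entry 0 0 x * entry 0 1 y - entry 0 1 x * entry 0 0 y))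
      (2 * (entry 1 0 x * entry 0 0 y - entry 0 0 x * entry 1 0 y)) := by
  apply ext_entry <;> rw [entry_lie]
  · rw [entry_mk_zero_zero]; ring
  · rw [entry_mk_zero_one, entry_one_one, entry_one_one]; ring
  · rw [entry_mk_one_zero, entry_one_one, entry_one_one]; ring

theorem e_eq : e = mk 0 1 0 := by
  ext i j
  fin_cases i <;> fin_cases j <;> simp [e, mk]

theorem eq_combination (x : g) : x = entry 0 1 x • e + entry 0 0 x • h + entry 1 0 x • f := by
  rw [e_eq]
  apply ext_entry <;> simp [h, f]

theorem lie_h_e : ⁅h, e⁆ = (2 : ℂ) • e := by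
  rw [e_eq, lie_eq_mk]
  apply ext_entry <;> simp [h]

theorem lie_h_f : ⁅h, f⁆ = (-2 : ℂ) • f := by
  rw [lie_eq_mk]
  apply ext_entry <;> simp [h, f]

theorem lie_e_f : ⁅e, f⁆ = h := by
  rw [e_eq, lie_eq_mk]
  apply ext_entry <;> simp [h, f]

/-- The coordinates `(a, b, c)` of `(a b; c -a)`. -/
def coords : g ≃ₗ[ℂ] (Fin 3 → ℂ) where
  toFun x := ![entry 0 0 x, entry 0 1 x, entry 1 0 x]
  map_add' x y := by ext i; fin_cases i <;> simp
  map_smul' c x := by ext i; fin_cases i <;> simp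
  invFun v := mk (v 0) (v 1) (v 2)
  left_inv x := by apply ext_entry <;> simp
  right_inv v := by ext i; fin_cases i <;> simp

theorem killingForm_eq (x y : g) : killingForm ℂ g x y =
    8 * (entry 0 0 x * entry 0 0 y) +
      4 * (entry 0 1 x * entry 1 0 y + entry 1 0 x * entry 0 1 y) := by
  rw [killingForm_apply_apply, LinearMap.trace_eq_matrix_trace ℂ (Module.Basis.ofEquivFun coords),
    Matrix.trace, Fin.sum_univ_three]
  have hb (i : Fin 3) : Module.Basis.ofEquivFun coords i = mk ((Pi.single i 1 : Fin 3 → ℂ) 0)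
      ((Pi.single i 1 : Fin 3 → ℂ) 1) ((Pi.single i 1 : Fin 3 → ℂ) 2) := by
    rw [Module.Basis.coe_ofEquivFun]
    rfl
  simp only [Matrix.diag_apply, LinearMap.toMatrix_apply, hb, Module.Basis.ofEquivFun_repr_apply]
  simp only [coords, Pi.single_eq_same, ne_eq, one_ne_zero, not_false_eq_true,
    Pi.single_eq_of_ne, Fin.reduceEq, LinearMap.coe_comp, Function.comp_apply,
    LieAlgebra.ad_apply, lie_eq_mk, entry_mk_one_zero, mul_zero, entry_mk_zero_one, sub_self,
    entry_mk_zero_zero, mul_one, zero_sub, mul_neg, sub_zero, sub_neg_eq_add, LinearEquiv.coe_mk,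
    LinearMap.coe_mk, AddHom.coe_mk, Matrix.cons_val_zero, zero_ne_one, Matrix.cons_val_one,
    Matrix.cons_val]
  ring

/-! ### The minimal orbit closure as a quotient of the plane -/

/-- The ring of polynomial functions on the plane. -/
abbrev P : Type := MvPolynomial (Fin 2) ℂ

/-- The first coordinate of the plane. -/
abbrev u : P := MvPolynomial.X 0

/-- The second coordinate of the plane. -/
abbrev v : P := MvPolynomial.X 1

/-- The quadratic form `w ↦ det (w, x w)` on the plane attached to `x` in `𝔤`. -/
def quad : g →ₗ[ℂ] P :=
  (entry 1 0).smulRight (u ^ 2) - (entry 0 0).smulRight (2 * u * v) -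
    (entry 0 1).smulRight (v ^ 2)

theorem quad_apply (x : g) : quad x = MvPolynomial.C (entry 1 0 x) * u ^ 2 -
    MvPolynomial.C (entry 0 0 x) * (2 * u * v) - MvPolynomial.C (entry 0 1 x) * v ^ 2 := by
  simp [quad, MvPolynomial.smul_eq_C_mul]

theorem quad_e : quad e = -v ^ 2 := by simp [quad_apply, e_eq]
theorem quad_h : quad h = -(2 * u * v) := by simp [quad_apply, h]
theorem quad_f : quad f = u ^ 2 := by simp [quad_apply, f]

/-- The pull-back along `quad` of the polynomial functions on `𝔤*`. -/
def rhoS : S →ₐ[ℂ] P := SymmetricAlgebra.lift quad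

@[simp] theorem rhoS_ι (x : g) : rhoS (SymmetricAlgebra.ι ℂ g x) = quad x :=
  SymmetricAlgebra.lift_ι_apply _ x

/-- The parametrization `p ↦ det (p, ·) p` of the nilpotent cone by the plane. -/
def orbitPoint (p : Fin 2 → ℂ) : g := mk (-(p 0 * p 1)) (p 0 ^ 2) (-(p 1 ^ 2))

theorem lift_orbitPoint (p : Fin 2 → ℂ) (a : S) :
    SymmetricAlgebra.lift (killingForm ℂ g (orbitPoint p)) a =
      MvPolynomial.eval (fun i => 2 * p i) (rhoS a) := by
  have hlift : SymmetricAlgebra.lift (killingForm ℂ g (orbitPoint p)) =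
      (MvPolynomial.aeval (fun i => 2 * p i)).comp rhoS := by
    apply SymmetricAlgebra.algHom_ext
    ext x
    simp only [orbitPoint, SymmetricAlgebra.lift_comp_ι, killingForm_eq, entry_mk_zero_zero,
      entry_mk_zero_one, entry_mk_one_zero, LinearMap.coe_comp, LinearMap.coe_coe, AlgHom.coe_comp,
      MvPolynomial.aeval_eq_eval, Function.comp_apply, rhoS_ι, quad_apply, map_sub, map_mul,
      MvPolynomial.eval_C, map_pow, MvPolynomial.eval_X, MvPolynomial.eval_ofNat]
    ring
  rw [hlift, AlgHom.comp_apply, MvPolynomial.aeval_eq_eval]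

theorem coe_orbitPoint_col (γ : Matrix.SpecialLinearGroup (Fin 2) ℂ) :
    (orbitPoint (fun i => γ i 0) : Matrix (Fin 2) (Fin 2) ℂ) =
      (γ : Matrix (Fin 2) (Fin 2) ℂ) * (e : Matrix (Fin 2) (Fin 2) ℂ) *
        ((γ⁻¹ : Matrix.SpecialLinearGroup (Fin 2) ℂ) : Matrix (Fin 2) (Fin 2) ℂ) := by
  rw [Matrix.SpecialLinearGroup.coe_inv, Matrix.adjugate_fin_two, e_eq]
  ext i j
  fin_cases i <;> fin_cases j <;>
    simp [orbitPoint, mk, Matrix.mul_apply, Fin.sum_univ_two] <;> ring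

theorem mem_Omin_iff (ξ : Module.Dual ℂ g) :
    ξ ∈ Omin ↔ ∃ p : Fin 2 → ℂ, p ≠ 0 ∧ killingForm ℂ g (orbitPoint p) = ξ := by
  constructor
  · rintro ⟨γ, y, hy, rfl⟩
    refine ⟨fun i => γ i 0, (γ.isCoprime_col 0).ne_zero, ?_⟩
    rw [Subtype.ext ((coe_orbitPoint_col γ).trans hy.symm)]
  · rintro ⟨p, hp, rfl⟩
    have hcop : IsCoprime (p 0) (p 1) := by
      rw [Semifield.isCoprime_iff]
      by_contra! h0
      exact hp (funext (Fin.forall_fin_two.2 h0))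
    obtain ⟨γ, h0, h1⟩ := hcop.exists_SL2_col 0
    refine ⟨γ, orbitPoint p, ?_, rfl⟩
    have hcol : (fun i => γ i 0) = p := funext (Fin.forall_fin_two.2 ⟨h0, h1⟩)
    rw [← coe_orbitPoint_col, hcol]

theorem mem_I_iff (a : S) : a ∈ I ↔ rhoS a = 0 := by
  change (∀ ξ ∈ Omin, SymmetricAlgebra.lift ξ a = 0) ↔ _
  constructor
  · refine fun ha => eq_zero_of_eval_eq_zero_of_ne_zero fun p hp => ?_
    have hp2 : (fun i => 2 * ((2⁻¹ : ℂ) • p) i) = p := by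
      ext i
      simp
    rw [← hp2, ← lift_orbitPoint]
    exact ha _ ((mem_Omin_iff _).2 ⟨_, smul_ne_zero (by norm_num) hp, rfl⟩)
  · rintro ha ξ hξ
    obtain ⟨p, -, rfl⟩ := (mem_Omin_iff ξ).1 hξ
    rw [lift_orbitPoint, ha, map_zero]

/-- The coordinate ring of the orbit closure as a ring of functions on the plane. -/
def rho : R →ₐ[ℂ] P := Ideal.Quotient.liftₐ I rhoS (fun a ha => (mem_I_iff a).1 ha)

@[simp] theorem rho_proj (a : S) : rho (proj a) = rhoS a := rfl

@[simp] theorem rho_mom (x : g) : rho (mom x) = quad x := rhoS_ι x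

theorem proj_surjective : Function.Surjective proj := Ideal.Quotient.mk_surjective

theorem rho_injective : Function.Injective rho := by
  rw [injective_iff_map_eq_zero]
  intro r hr
  obtain ⟨a, rfl⟩ := proj_surjective r
  exact Ideal.Quotient.eq_zero_iff_mem.2 ((mem_I_iff a).2 hr)

/-! ### The Poisson bracket in the plane -/

/-- The derivative with respect to the first coordinate. -/
abbrev du : Derivation ℂ P P := MvPolynomial.pderiv 0

/-- The derivative with respect to the second coordinate. -/
abbrev dv : Derivation ℂ P P := MvPolynomial.pderiv 1

@[simp] theorem du_u : du u = 1 := MvPolynomial.pderiv_X_self 0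
@[simp] theorem dv_v : dv v = 1 := MvPolynomial.pderiv_X_self 1
@[simp] theorem du_v : du v = 0 := MvPolynomial.pderiv_X_of_ne (by decide)
@[simp] theorem dv_u : dv u = 0 := MvPolynomial.pderiv_X_of_ne (by decide)

/-- The Hamiltonian vector field of a function on the plane. The factor `-1/2` is the one for which
`quad` is a homomorphism of Lie algebras. -/
def ham (F : P) : Derivation ℂ P P :=
  (MvPolynomial.C (-1 / 2 : ℂ) : P) • (du F • dv - dv F • du)

theorem ham_apply (F G : P) :
    ham F G = MvPolynomial.C (-1 / 2 : ℂ) * (du F * dv G - dv F * du G) := by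
  simp [ham]

theorem C_neg_half_mul_two : (MvPolynomial.C (-1 / 2 : ℂ) : P) * 2 = -1 := by
  rw [← map_ofNat MvPolynomial.C 2, ← map_mul]
  simp

@[simp] theorem derivation_two (D : Derivation ℂ P P) : D 2 = 0 := D.map_natCast 2

theorem ham_quad (x : g) (G : P) : ham (quad x) G =
    -(MvPolynomial.C (entry 0 1 x) * (v * du G)) +
      MvPolynomial.C (entry 0 0 x) * (v * dv G - u * du G) -
      MvPolynomial.C (entry 1 0 x) * (u * dv G) := by
  rw [ham_apply, quad_apply]
  simp only [map_sub, Derivation.leibniz, Derivation.leibniz_pow, MvPolynomial.pderiv_C,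
    derivation_two, smul_eq_mul, du_u, dv_v, du_v, dv_u, nsmul_eq_mul]
  push_cast
  linear_combination (MvPolynomial.C (entry 1 0 x) * (u * dv G) -
    MvPolynomial.C (entry 0 0 x) * (v * dv G - u * du G) +
    MvPolynomial.C (entry 0 1 x) * (v * du G)) * C_neg_half_mul_two

theorem ham_quad_quad (x y : g) : ham (quad x) (quad y) = quad ⁅x, y⁆ := by
  rw [ham_quad]
  simp only [quad_apply, lie_eq_mk, map_sub, Derivation.leibniz, Derivation.leibniz_pow,
    Nat.add_one_sub_one, pow_one, MvPolynomial.pderiv_X, Pi.single_eq_same, smul_eq_mul, mul_one,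
    nsmul_eq_mul, Nat.cast_ofNat, MvPolynomial.derivation_C, mul_zero, add_zero, ne_eq,
    one_ne_zero, not_false_eq_true, Pi.single_eq_of_ne, derivation_two, zero_add,
    sub_zero, zero_ne_one, zero_sub, entry_mk_one_zero, MvPolynomial.C_mul,
    map_ofNat MvPolynomial.C 2, entry_mk_zero_zero, entry_mk_zero_one]
  ring

theorem rhoS_poisson_ι (x : g) (a : S) :
    rhoS (poisson (SymmetricAlgebra.ι ℂ g x) a) = ham (quad x) (rhoS a) := by
  rw [poisson, symDer_ι]
  change rhoS (symDer _ a) = _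
  induction a using SymmetricAlgebra.induction with
  | algebraMap r => simp
  | ι y => rw [symDer_ι, rhoS_ι, ham_quad_quad]; exact rhoS_ι _
  | mul a b ha hb => simp [ha, hb]
  | add a b ha hb => simp [ha, hb]

theorem rhoS_poisson (a b : S) : rhoS (poisson a b) = ham (rhoS a) (rhoS b) := by
  induction a using SymmetricAlgebra.induction with
  | algebraMap r => simp [poisson, ham_apply]
  | ι x => rw [rhoS_poisson_ι, rhoS_ι]
  | mul a b ha hb =>
    rw [poisson] at ha hb ⊢
    simp only [Derivation.leibniz, map_add, smul_eq_mul, map_mul, ha, hb, ham_apply]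
    ring
  | add a b ha hb =>
    rw [poisson] at ha hb ⊢
    simp only [map_add, ha, hb, ham_apply]
    ring

/-! ### The grading of `R` -/

theorem Rgr_natCast (k : ℕ) : Rgr k = (LinearMap.range mom) ^ k := by simp [Rgr]

theorem Rgr_of_neg {d : ℤ} (hd : d < 0) : Rgr d = ⊥ := by simp [Rgr, hd]

theorem Rgr_zero : Rgr 0 = 1 := Rgr_natCast 0

theorem mom_mem_Rgr (x : g) : mom x ∈ Rgr 1 := by
  rw [← Nat.cast_one, Rgr_natCast, pow_one]
  exact ⟨x, rfl⟩

theorem map_mem_Rgr {T : Module.End ℂ R} {m : ℤ} (hT : ∀ k : ℕ, ∀ r ∈ Rgr k, T r ∈ Rgr (k + m))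
    {d : ℤ} {r : R} (hr : r ∈ Rgr d) : T r ∈ Rgr (d + m) := by
  rcases lt_or_ge d 0 with hd | hd
  · rw [Rgr_of_neg hd, Submodule.mem_bot] at hr
    rw [hr, map_zero]
    exact zero_mem _
  · lift d to ℕ using hd
    exact hT d r hr

theorem iSup_Rgr : ⨆ k : ℕ, Rgr k = ⊤ := by
  simp only [Rgr_natCast]
  rw [eq_top_iff]
  rintro r -
  obtain ⟨a, rfl⟩ := proj_surjective r
  induction a using SymmetricAlgebra.induction with
  | algebraMap c =>
    refine Submodule.mem_iSup_of_mem 0 ?_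
    rw [AlgHom.commutes, pow_zero]
    exact Submodule.algebraMap_mem c
  | ι x =>
    refine Submodule.mem_iSup_of_mem 1 ?_
    rw [pow_one]
    exact ⟨x, rfl⟩
  | mul a b ha hb =>
    rw [map_mul]
    exact iSup_pow_mul_iSup_pow_le _ (Submodule.mul_mem_mul ha hb)
  | add a b ha hb => rw [map_add]; exact add_mem ha hb

theorem eq_top_of_Rgr_le {M : Submodule ℂ R} (hM : ∀ k : ℕ, Rgr k ≤ M) : M = ⊤ :=
  top_le_iff.1 (iSup_Rgr ▸ iSup_le hM)

theorem end_ext_Rgr {N : Type*} [AddCommMonoid N] [Module ℂ N] {T T' : R →ₗ[ℂ] N}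
    (h : ∀ k : ℕ, ∀ r ∈ Rgr k, T r = T' r) : T = T' :=
  LinearMap.eqLocus_eq_top.1 (eq_top_of_Rgr_le h)

theorem range_quad : LinearMap.range quad = MvPolynomial.homogeneousSubmodule (Fin 2) ℂ 2 := by
  have hu : u.IsHomogeneous 1 := MvPolynomial.isHomogeneous_X ℂ 0
  have hv : v.IsHomogeneous 1 := MvPolynomial.isHomogeneous_X ℂ 1
  apply le_antisymm
  · rintro _ ⟨x, rfl⟩
    rw [quad_apply, ← map_ofNat MvPolynomial.C 2]
    exact (((hu.pow 2).C_mul _).sub (((hu.C_mul 2).mul hv).C_mul _)).sub ((hv.pow 2).C_mul _)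
  · refine fun F hF => mem_of_monomial_mem fun m hm => ?_
    have hm2 : m 0 + m 1 = 2 := by
      rw [← Fin.sum_univ_two, ← Finsupp.degree_eq_sum, Finsupp.degree_apply]
      exact (hF.degree_eq_sum_deg_support hm).symm
    obtain ⟨h0, h1⟩ | ⟨h0, h1⟩ | ⟨h0, h1⟩ : m 0 = 0 ∧ m 1 = 2 ∨ m 0 = 1 ∧ m 1 = 1 ∨
      m 0 = 2 ∧ m 1 = 0 := by omega
    all_goals rw [monomial_one_fin_two, h0, h1]
    · exact ⟨-e, by rw [map_neg, quad_e]; ring⟩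
    · exact ⟨(-1 / 2 : ℂ) • h, by
        rw [map_smul, quad_h, MvPolynomial.smul_eq_C_mul]
        linear_combination (-u * v) * C_neg_half_mul_two⟩
    · exact ⟨f, by rw [quad_f]; ring⟩

theorem range_quad_pow (k : ℕ) :
    (LinearMap.range quad) ^ k = MvPolynomial.homogeneousSubmodule (Fin 2) ℂ (2 * k) := by
  rw [range_quad, ← MvPolynomial.homogeneousSubmodule_one_pow _ 2,
    ← MvPolynomial.homogeneousSubmodule_one_pow _ (2 * k), pow_mul]

theorem map_rho_Rgr (k : ℕ) :
    (Rgr k).map rho.toLinearMap = MvPolynomial.homogeneousSubmodule (Fin 2) ℂ (2 * k) := by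
  have hrange : (LinearMap.range mom).map rho.toLinearMap = LinearMap.range quad := by
    rw [← LinearMap.range_comp, show rho.toLinearMap ∘ₗ mom = quad from LinearMap.ext rho_mom]
  rw [Rgr_natCast, Submodule.map_pow, hrange, range_quad_pow]

theorem mem_Rgr_iff (k : ℕ) (r : R) : r ∈ Rgr k ↔ (rho r).IsHomogeneous (2 * k) := by
  rw [← MvPolynomial.mem_homogeneousSubmodule, ← map_rho_Rgr]
  exact (rho_injective.mem_set_image (s := (Rgr k : Set R))).symm

theorem even_degree_of_mem_support_rho {r : R} {m : Fin 2 →₀ ℕ} (hm : m ∈ (rho r).support) :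
    Even m.degree := by
  contrapose! hm
  have hT : MvPolynomial.lcoeff ℂ m ∘ₗ rho.toLinearMap = 0 := by
    refine end_ext_Rgr fun k r hr => ((mem_Rgr_iff k r).1 hr).coeff_eq_zero fun hk => hm ?_
    exact hk ▸ even_two_mul k
  exact MvPolynomial.notMem_support_iff.2 (LinearMap.congr_fun hT r)

theorem mem_of_monomial_mem_map_rho {M : Submodule ℂ R} {r : R}
    (hM : ∀ m ∈ (rho r).support, MvPolynomial.monomial m 1 ∈ M.map rho.toLinearMap) : r ∈ M :=
  (rho_injective.mem_set_image (s := (M : Set R))).1 (mem_of_monomial_mem hM)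

theorem rho_mom_e_pow (k : ℕ) : rho ((-1 : ℂ) ^ k • mom e ^ k) = v ^ (2 * k) := by
  rw [map_smul, map_pow, rho_mom, quad_e, MvPolynomial.smul_eq_C_mul, map_pow, map_neg, map_one,
    ← mul_pow, pow_mul]
  ring

/-! ### Operators on `R` -/

theorem ham_rho_mem_range (r r' : R) : ham (rho r) (rho r') ∈ LinearMap.range rho.toLinearMap := by
  obtain ⟨a, rfl⟩ := proj_surjective r
  obtain ⟨b, rfl⟩ := proj_surjective r'
  exact ⟨proj (poisson a b), rhoS_poisson a b⟩

/-- The operator `{r, ·}` on `R`. -/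
def bracket (r : R) : Module.End ℂ R :=
  LinearMap.codRestrictOfInjective ((ham (rho r)).toLinearMap ∘ₗ rho.toLinearMap) rho.toLinearMap
    rho_injective (ham_rho_mem_range r)

@[simp] theorem rho_bracket (r r' : R) : rho (bracket r r') = ham (rho r) (rho r') :=
  LinearMap.codRestrictOfInjective_comp_apply ((ham (rho r)).toLinearMap ∘ₗ rho.toLinearMap)
    rho.toLinearMap _ _ r'

theorem bracket_proj (a b : S) : bracket (proj a) (proj b) = proj (poisson a b) :=
  rho_injective <| by rw [rho_bracket, rho_proj, rho_proj, rho_proj, rhoS_poisson]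

theorem bracket_mom_mom (x y : g) : bracket (mom x) (mom y) = mom ⁅x, y⁆ :=
  rho_injective <| by rw [rho_bracket, rho_mom, rho_mom, rho_mom, ham_quad_quad]

theorem bracket_mul (r s s' : R) : bracket r (s * s') = s * bracket r s' + s' * bracket r s :=
  rho_injective <| by simp

theorem bracket_algebraMap (r : R) (c : ℂ) : bracket r (algebraMap ℂ R c) = 0 :=
  rho_injective <| by simp

theorem bracket_mom_mem_Rgr (x : g) {d : ℤ} {r : R} (hr : r ∈ Rgr d) :
    bracket (mom x) r ∈ Rgr d := by
  rw [← add_zero d]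
  refine map_mem_Rgr (fun k r hr => ?_) hr
  rw [add_zero, Rgr_natCast] at *
  induction hr using Submodule.pow_induction_on_left' with
  | algebraMap c => rw [bracket_algebraMap]; exact zero_mem _
  | add r s n _ _ ihr ihs => rw [map_add]; exact add_mem ihr ihs
  | mem_mul m hm n r hr ih =>
    obtain ⟨y, rfl⟩ := hm
    rw [bracket_mul, bracket_mom_mom, mul_comm r, pow_succ']
    exact add_mem (Submodule.mul_mem_mul ⟨y, rfl⟩ ih) (Submodule.mul_mem_mul ⟨_, rfl⟩ hr)

/-- Multiplication by `μ_x` on `R`. -/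
def mulMom (x : g) : Module.End ℂ R := LinearMap.mulLeft ℂ (mom x)

@[simp] theorem mulMom_apply (x : g) (r : R) : mulMom x r = mom x * r := rfl

theorem mulMom_mem_Rgr (x : g) {d : ℤ} {r : R} (hr : r ∈ Rgr d) : mulMom x r ∈ Rgr (d + 1) := by
  refine map_mem_Rgr (fun k r hr => ?_) hr
  rw [← Nat.cast_succ, Rgr_natCast, pow_succ']
  rw [Rgr_natCast] at hr
  exact Submodule.mul_mem_mul ⟨x, rfl⟩ hr

theorem mulMom_commute (x y : g) : mulMom x * mulMom y = mulMom y * mulMom x :=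
  LinearMap.ext fun r => mul_left_comm (mom x) (mom y) r

theorem bracket_mulMom (x y : g) :
    bracket (mom x) * mulMom y - mulMom y * bracket (mom x) =
      mulMom x * bracket (mom y) - bracket (mom y) * mulMom x := by
  ext r
  simp only [LinearMap.sub_apply, Module.End.mul_apply, mulMom_apply, bracket_mul, bracket_mom_mom]
  rw [← lie_skew x y, map_neg]
  ring

/-- The second order operator with constant coefficients attached to an element of `𝔤`: the form
`quad x` with `(u, v)` replaced by `(∂_v, -∂_u)`. -/
def diffTwo (x : g) : P →ₗ[ℂ] P :=
  entry 1 0 x • dv.toLinearMap ∘ₗ dv.toLinearMap +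
    (2 * entry 0 0 x) • du.toLinearMap ∘ₗ dv.toLinearMap -
    entry 0 1 x • du.toLinearMap ∘ₗ du.toLinearMap

theorem diffTwo_apply (x : g) (F : P) : diffTwo x F =
    MvPolynomial.C (entry 1 0 x) * dv (dv F) +
      MvPolynomial.C (entry 0 0 x) * (2 * du (dv F)) -
      MvPolynomial.C (entry 0 1 x) * du (du F) := by
  simp only [diffTwo, LinearMap.sub_apply, LinearMap.add_apply, LinearMap.smul_apply,
    LinearMap.comp_apply, Derivation.coeFn_coe,
    MvPolynomial.smul_eq_C_mul, map_mul, map_ofNat]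
  ring

theorem diffTwo_isHomogeneous (x : g) {n : ℕ} {F : P} (hF : F.IsHomogeneous n) :
    (diffTwo x F).IsHomogeneous (n - 2) := by
  have hpderiv (i j : Fin 2) :
      (MvPolynomial.pderiv i (MvPolynomial.pderiv j F)).IsHomogeneous (n - 2) :=
    hF.pderiv.pderiv
  rw [diffTwo_apply, ← map_ofNat MvPolynomial.C 2]
  exact (((hpderiv 1 1).C_mul _).add (((hpderiv 0 1).C_mul 2).C_mul _)).sub ((hpderiv 0 0).C_mul _)

theorem dv_du (F : P) : dv (du F) = du (dv F) := pderiv_pderiv_comm 1 0 F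

theorem diffTwo_comm (x y : g) (F : P) :
    diffTwo x (diffTwo y F) = diffTwo y (diffTwo x F) := by
  simp only [diffTwo_apply, map_add, map_sub, Derivation.leibniz, MvPolynomial.pderiv_C,
    derivation_two, smul_eq_mul, dv_du, map_zero]
  ring

theorem ham_diffTwo (x y : g) (F : P) :
    ham (quad x) (diffTwo y F) - diffTwo y (ham (quad x) F) =
      diffTwo x (ham (quad y) F) - ham (quad y) (diffTwo x F) := by
  simp only [diffTwo_apply, ham_quad, map_add, map_sub, map_neg, Derivation.leibniz,
    MvPolynomial.pderiv_C, derivation_two, smul_eq_mul, dv_du, du_u, du_v, dv_u, dv_v, map_zero,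
    Derivation.map_one_eq_zero]
  ring

theorem euler {n : ℕ} {F : P} (hF : F.IsHomogeneous n) : u * du F + v * dv F = n * F := by
  rw [← nsmul_eq_mul, ← hF.sum_X_mul_pderiv, Fin.sum_univ_two]

theorem euler_du {n : ℕ} {F : P} (hF : F.IsHomogeneous n) :
    u * du (du F) + v * du (dv F) = (n - 1) * du F := by
  have h := congrArg du (euler hF)
  simp only [map_add, Derivation.leibniz, smul_eq_mul, du_u, du_v, Derivation.map_natCast] at h
  linear_combination h

theorem euler_dv {n : ℕ} {F : P} (hF : F.IsHomogeneous n) :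
    u * du (dv F) + v * dv (dv F) = (n - 1) * dv F := by
  have h := congrArg dv (euler hF)
  simp only [map_add, Derivation.leibniz, smul_eq_mul, dv_v, dv_u, Derivation.map_natCast,
    dv_du] at h
  linear_combination h

theorem quad_mul_diffTwo (x y : g) {n : ℕ} {c c' : ℂ} {F : P} (hF : F.IsHomogeneous n)
    (hc : c * (n - 1) - c' * (n + 3) = -1 / 4) :
    quad x * (c • diffTwo y F) - c' • diffTwo y (quad x * F) +
        (c' • diffTwo x (quad y * F) - quad y * (c • diffTwo x F)) =
      (1 / 4 : ℂ) • (ham (quad x) (ham (quad y) F) - ham (quad y) (ham (quad x) F)) := by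
  have hC : MvPolynomial.C c * ((n : P) - 1) - MvPolynomial.C c' * ((n : P) + 3) +
      MvPolynomial.C (1 / 4) = 0 := by
    have h := congrArg (MvPolynomial.C (σ := Fin 2)) hc
    simp only [map_sub, map_mul, map_add, map_natCast, map_one, map_ofNat] at h
    rw [h, ← map_add]
    norm_num
  simp only [ham_quad, MvPolynomial.smul_eq_C_mul]
  simp only [quad_apply, diffTwo_apply, map_add, map_sub, map_neg, Derivation.leibniz,
    MvPolynomial.pderiv_C, derivation_two, smul_eq_mul, dv_du, du_u, du_v, dv_u, dv_v, map_zero,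
    Derivation.map_one_eq_zero, Derivation.leibniz_pow, nsmul_eq_mul, Nat.cast_ofNat]
  linear_combination
    (MvPolynomial.C (entry 0 1 x) * MvPolynomial.C (entry 1 0 y) -
      MvPolynomial.C (entry 1 0 x) * MvPolynomial.C (entry 0 1 y)) *
      ((MvPolynomial.C c - MvPolynomial.C c') * (u * euler_du hF - v * euler_dv hF) +
        (u * du F - v * dv F) * hC) +
    (MvPolynomial.C (entry 0 0 x) * MvPolynomial.C (entry 0 1 y) -
      MvPolynomial.C (entry 0 1 x) * MvPolynomial.C (entry 0 0 y)) *
      (2 * v * ((MvPolynomial.C c - MvPolynomial.C c') * euler_du hF + du F * hC)) -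
    (MvPolynomial.C (entry 0 0 x) * MvPolynomial.C (entry 1 0 y) -
      MvPolynomial.C (entry 1 0 x) * MvPolynomial.C (entry 0 0 y)) *
      (2 * u * ((MvPolynomial.C c - MvPolynomial.C c') * euler_dv hF + dv F * hC))

/-- The coefficients of the second order terms in degree `n`, with `τ` the parameter of the family:
the general solution of the recursion `secondOrderCoeff_rec`. -/
def secondOrderCoeff (τ : ℂ) (n : ℕ) : ℂ := ((n : ℂ) ^ 2 - τ) / (16 * ((n : ℂ) ^ 2 - 1))

theorem secondOrderCoeff_rec (τ : ℂ) (k : ℕ) :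
    secondOrderCoeff τ (2 * k) * ((2 * k : ℕ) - 1) -
      secondOrderCoeff τ (2 * (k + 1)) * ((2 * k : ℕ) + 3) = -1 / 4 := by
  have h1 : 2 * (k : ℂ) - 1 ≠ 0 := by
    have h0 : 2 * (k : ℤ) - 1 ≠ 0 := by omega
    exact_mod_cast h0
  have h2 : 2 * (k : ℂ) + 1 ≠ 0 := by exact_mod_cast Nat.succ_ne_zero (2 * k)
  have h3 : 2 * (k : ℂ) + 3 ≠ 0 := by exact_mod_cast Nat.succ_ne_zero (2 * k + 2)
  have e1 : ((2 * k : ℕ) : ℂ) ^ 2 - 1 = (2 * k - 1) * (2 * k + 1) := by push_cast; ring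
  have e2 : ((2 * (k + 1) : ℕ) : ℂ) ^ 2 - 1 = (2 * k + 1) * (2 * k + 3) := by push_cast; ring
  rw [secondOrderCoeff, secondOrderCoeff, e1, e2]
  push_cast
  field_simp
  ring

theorem diffTwo_scaleDegree_mem_range (c : ℕ → ℂ) (x : g) (r : R) :
    diffTwo x (scaleDegree c (rho r)) ∈ LinearMap.range rho.toLinearMap := by
  have htop : (LinearMap.range rho.toLinearMap).comap
      (diffTwo x ∘ₗ scaleDegree c ∘ₗ rho.toLinearMap) = ⊤ := by
    refine eq_top_of_Rgr_le fun k r hr => ?_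
    have hr := (mem_Rgr_iff k r).1 hr
    have hdiff : diffTwo x (rho r) ∈ (Rgr (k - 1 : ℕ)).map rho.toLinearMap := by
      rw [map_rho_Rgr, Nat.mul_sub]
      exact diffTwo_isHomogeneous x hr
    rw [Submodule.mem_comap, LinearMap.comp_apply, LinearMap.comp_apply, AlgHom.toLinearMap_apply,
      scaleDegree_of_isHomogeneous c hr, map_smul]
    exact Submodule.smul_mem _ _ (LinearMap.map_le_range hdiff)
  exact (Submodule.mem_comap.1 (htop ▸ Submodule.mem_top) :)

/-- The second order part of the left multiplication by `μ_x`. -/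
def secondOrder (τ : ℂ) (x : g) : Module.End ℂ R :=
  LinearMap.codRestrictOfInjective
    (diffTwo x ∘ₗ scaleDegree (secondOrderCoeff τ) ∘ₗ rho.toLinearMap) rho.toLinearMap
    rho_injective (diffTwo_scaleDegree_mem_range _ x)

theorem rho_secondOrder (τ : ℂ) (x : g) {k : ℕ} {r : R} (hr : r ∈ Rgr k) :
    rho (secondOrder τ x r) = secondOrderCoeff τ (2 * k) • diffTwo x (rho r) := by
  rw [← map_smul, ← scaleDegree_of_isHomogeneous _ ((mem_Rgr_iff k r).1 hr)]
  exact LinearMap.codRestrictOfInjective_comp_apply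
    (diffTwo x ∘ₗ scaleDegree (secondOrderCoeff τ) ∘ₗ rho.toLinearMap) rho.toLinearMap _ _ r

theorem secondOrder_mem_Rgr_pred (τ : ℂ) (x : g) {k : ℕ} {r : R} (hr : r ∈ Rgr k) :
    secondOrder τ x r ∈ Rgr (k - 1 : ℕ) := by
  rw [mem_Rgr_iff, rho_secondOrder τ x hr, Nat.mul_sub, MvPolynomial.smul_eq_C_mul]
  exact (diffTwo_isHomogeneous x ((mem_Rgr_iff k r).1 hr)).C_mul _

theorem secondOrder_algebraMap (τ : ℂ) (x : g) (c : ℂ) :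
    secondOrder τ x (algebraMap ℂ R c) = 0 := by
  apply rho_injective
  rw [rho_secondOrder τ x (k := 0) (Rgr_zero ▸ Submodule.algebraMap_mem c)]
  simp [diffTwo_apply]

theorem secondOrder_mem_Rgr (τ : ℂ) (x : g) {d : ℤ} {r : R} (hr : r ∈ Rgr d) :
    secondOrder τ x r ∈ Rgr (d - 1) := by
  refine map_mem_Rgr (m := -1) (fun k r hr => ?_) hr
  rcases k with _ | k
  · obtain ⟨c, rfl⟩ := Submodule.mem_one.1 (Rgr_zero ▸ hr)
    rw [secondOrder_algebraMap]
    exact zero_mem _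
  · simpa using secondOrder_mem_Rgr_pred τ x hr

theorem bracket_secondOrder (τ : ℂ) (x y : g) :
    bracket (mom x) * secondOrder τ y - secondOrder τ y * bracket (mom x) =
      secondOrder τ x * bracket (mom y) - bracket (mom y) * secondOrder τ x := by
  refine end_ext_Rgr fun k r hr => rho_injective ?_
  simp only [LinearMap.sub_apply, Module.End.mul_apply, map_sub, rho_bracket, rho_mom,
    rho_secondOrder τ _ hr, rho_secondOrder τ _ (bracket_mom_mem_Rgr _ hr), Derivation.map_smul]
  rw [← smul_sub, ham_diffTwo, smul_sub]

theorem secondOrder_commute (τ : ℂ) (x y : g) :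
    secondOrder τ x * secondOrder τ y = secondOrder τ y * secondOrder τ x := by
  refine end_ext_Rgr fun k r hr => rho_injective ?_
  simp only [Module.End.mul_apply, rho_secondOrder τ _ (secondOrder_mem_Rgr_pred τ _ hr),
    rho_secondOrder τ _ hr, map_smul, diffTwo_comm x y]

theorem mulMom_secondOrder (τ : ℂ) (x y : g) :
    mulMom x * secondOrder τ y - secondOrder τ y * mulMom x +
        (secondOrder τ x * mulMom y - mulMom y * secondOrder τ x) =
      (1 / 4 : ℂ) •
        (bracket (mom x) * bracket (mom y) - bracket (mom y) * bracket (mom x)) := by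
  refine end_ext_Rgr fun k r hr => rho_injective ?_
  have hmul (z : g) : mom z * r ∈ Rgr (k + 1 : ℕ) := mulMom_mem_Rgr z hr
  simp only [LinearMap.add_apply, LinearMap.sub_apply, LinearMap.smul_apply, Module.End.mul_apply,
    map_add, map_sub, map_smul, mulMom_apply, map_mul, rho_mom, rho_bracket,
    rho_secondOrder τ _ (hmul _), rho_secondOrder τ _ hr]
  exact quad_mul_diffTwo x y ((mem_Rgr_iff k r).1 hr) (secondOrderCoeff_rec τ k)

/-! ### A one-parameter family of star products -/

/-- The operator on `R[t]` of left multiplication by `μ_x` in the star product with parameter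
`τ`. -/
def leftMul (τ : ℂ) (x : g) : Module.End ℂ R[X] :=
  extendQuadratic (mulMom x) ((1 / 2 : ℂ) • bracket (mom x)) (secondOrder τ x)

/-- The operator on `R[t]` of right multiplication by `μ_x`, obtained from `leftMul` by `t ↦ -t`. -/
def rightMul (τ : ℂ) (x : g) : Module.End ℂ R[X] :=
  extendQuadratic (mulMom x) (-(1 / 2 : ℂ) • bracket (mom x)) (secondOrder τ x)

theorem leftMul_commute_rightMul (τ : ℂ) (x y : g) : Commute (leftMul τ x) (rightMul τ y) := by
  apply commute_extendQuadratic
  · exact mulMom_commute x y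
  · simp only [smul_mul_assoc, mul_smul_comm]
    linear_combination (norm := module) (1 / 2 : ℂ) • bracket_mulMom x y
  · simp only [smul_mul_assoc, mul_smul_comm, smul_smul]
    linear_combination (norm := module) mulMom_secondOrder τ x y
  · simp only [smul_mul_assoc, mul_smul_comm]
    linear_combination (norm := module) (1 / 2 : ℂ) • bracket_secondOrder τ x y
  · exact secondOrder_commute τ x y

/-- The algebra of operators generated by `t` and the left multiplications by the `μ_x`. -/
def leftAlg (τ : ℂ) : Subalgebra ℂ (Module.End ℂ R[X]) :=
  Algebra.adjoin ℂ (insert mulX (Set.range (leftMul τ)))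

/-- The algebra of operators generated by `t` and the right multiplications by the `μ_x`. -/
def rightAlg (τ : ℂ) : Subalgebra ℂ (Module.End ℂ R[X]) :=
  Algebra.adjoin ℂ (insert mulX (Set.range (rightMul τ)))

theorem mulX_mem_leftAlg (τ : ℂ) : mulX ∈ leftAlg τ := Algebra.subset_adjoin (Set.mem_insert _ _)

theorem mulX_mem_rightAlg (τ : ℂ) : mulX ∈ rightAlg τ := Algebra.subset_adjoin (Set.mem_insert _ _)

theorem leftMul_mem_leftAlg (τ : ℂ) (x : g) : leftMul τ x ∈ leftAlg τ :=
  Algebra.subset_adjoin (Set.mem_insert_of_mem _ ⟨x, rfl⟩)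

theorem rightMul_mem_rightAlg (τ : ℂ) (x : g) : rightMul τ x ∈ rightAlg τ :=
  Algebra.subset_adjoin (Set.mem_insert_of_mem _ ⟨x, rfl⟩)

theorem leftAlg_commute_rightAlg (τ : ℂ) (a : Module.End ℂ R[X]) (ha : a ∈ leftAlg τ)
    (b : Module.End ℂ R[X]) (hb : b ∈ rightAlg τ) : Commute a b := by
  refine Algebra.commute_of_mem_adjoin_of_forall_mem_commute hb fun b' hb' =>
    (Algebra.commute_of_mem_adjoin_of_forall_mem_commute ha fun a' ha' => ?_).symm
  rcases ha' with rfl | ⟨x, rfl⟩ <;> rcases hb' with rfl | ⟨y, rfl⟩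
  · exact Commute.refl _
  · exact (mulX_commute_extendQuadratic _ _ _).symm
  · exact mulX_commute_extendQuadratic _ _ _
  · exact (leftMul_commute_rightMul τ x y).symm

theorem leftMul_C (τ : ℂ) (x : g) (r : R) : leftMul τ x (Polynomial.C r) =
    Polynomial.C (mom x * r) + Polynomial.X * Polynomial.C ((1 / 2 : ℂ) • bracket (mom x) r) +
      Polynomial.X * (Polynomial.X * Polynomial.C (secondOrder τ x r)) :=
  extendQuadratic_C _ _ _ r

theorem leftMul_one (τ : ℂ) (x : g) : leftMul τ x 1 = Polynomial.C (mom x) := by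
  rw [← Polynomial.C_1, leftMul_C, ← map_one (algebraMap ℂ R), bracket_algebraMap,
    secondOrder_algebraMap]
  simp

theorem conj_flip_leftMul (τ : ℂ) (x : g) : flip.conjAlgEquiv ℂ (leftMul τ x) = rightMul τ x := by
  rw [leftMul, conj_flip_extendQuadratic, rightMul, smul_smul, neg_one_mul]

theorem flip_one : flip (K := ℂ) (1 : R[X]) = 1 := flip_C 1

theorem rightMul_one (τ : ℂ) (x : g) : rightMul τ x 1 = Polynomial.C (mom x) := by
  rw [← conj_flip_leftMul, conjAlgEquiv_apply_of_apply_eq flip_one, leftMul_one, flip_C]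

theorem conj_flip_mem_rightAlg (τ : ℂ) (a : Module.End ℂ R[X]) (ha : a ∈ leftAlg τ) :
    flip.conjAlgEquiv ℂ a ∈ rightAlg τ := by
  have hle : leftAlg τ ≤ (rightAlg τ).comap (flip.conjAlgEquiv ℂ).toAlgHom := by
    refine Algebra.adjoin_le ?_
    rintro _ (rfl | ⟨x, rfl⟩)
    · have hX := Subalgebra.smul_mem _ (mulX_mem_rightAlg τ) (-1 : ℂ)
      rwa [← conj_flip_mulX] at hX
    · have hx := rightMul_mem_rightAlg τ x
      rwa [← conj_flip_leftMul] at hx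
  exact hle ha

/-- The elements of `R[t]` of total degree `n`, where `t` has degree one. -/
def totalGr (n : ℤ) : Submodule ℂ R[X] where
  carrier := {F | ∀ p : ℕ, F.coeff p ∈ Rgr (n - p)}
  add_mem' hF hG p := by rw [Polynomial.coeff_add]; exact add_mem (hF p) (hG p)
  zero_mem' p := by rw [Polynomial.coeff_zero]; exact zero_mem _
  smul_mem' c F hF p := by rw [Polynomial.coeff_smul]; exact Submodule.smul_mem _ c (hF p)

theorem C_mem_totalGr {d : ℤ} {r : R} (hr : r ∈ Rgr d) : Polynomial.C r ∈ totalGr d := by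
  rintro (_ | p)
  · simpa using hr
  · rw [Polynomial.coeff_C_succ]
    exact zero_mem _

/-- The operators on `R[t]` that raise the total degree by `d`. -/
def raising (d : ℤ) : Submodule ℂ (Module.End ℂ R[X]) where
  carrier := {T | ∀ n, ∀ F ∈ totalGr n, T F ∈ totalGr (n + d)}
  add_mem' hT hT' n F hF := add_mem (hT n F hF) (hT' n F hF)
  zero_mem' _ _ _ := zero_mem _
  smul_mem' c _ hT n F hF := Submodule.smul_mem _ c (hT n F hF)

theorem mul_mem_raising {T T' : Module.End ℂ R[X]} {d d' : ℤ} (hT : T ∈ raising d)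
    (hT' : T' ∈ raising d') : T * T' ∈ raising (d + d') := fun n F hF => by
  rw [add_comm d, ← add_assoc]
  exact hT _ _ (hT' n F hF)

theorem mulX_mem_raising : mulX ∈ raising 1 := by
  rintro n F hF (_ | p)
  · simp
  · rw [mulX_apply, Polynomial.coeff_X_mul, Nat.cast_succ, add_sub_add_right_eq_sub]
    exact hF p

theorem extend_mem_raising {T : Module.End ℂ R} {d : ℤ}
    (hT : ∀ k : ℤ, ∀ r ∈ Rgr k, T r ∈ Rgr (k + d)) : extend T ∈ raising d := fun n F hF p => by
  rw [coeff_extend, add_sub_right_comm]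
  exact hT _ _ (hF p)

theorem extendQuadratic_mem_raising {a b c : Module.End ℂ R} {d : ℤ}
    (ha : ∀ k : ℤ, ∀ r ∈ Rgr k, a r ∈ Rgr (k + (1 + d)))
    (hb : ∀ k : ℤ, ∀ r ∈ Rgr k, b r ∈ Rgr (k + d))
    (hc : ∀ k : ℤ, ∀ r ∈ Rgr k, c r ∈ Rgr (k + (d - 1))) :
    extendQuadratic a b c ∈ raising (1 + d) := by
  have hXc := mul_mem_raising mulX_mem_raising (extend_mem_raising hc)
  rw [add_sub_cancel] at hXc
  exact add_mem (add_mem (extend_mem_raising ha)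
    (mul_mem_raising mulX_mem_raising (extend_mem_raising hb)))
    (mul_mem_raising mulX_mem_raising hXc)

theorem leftMul_mem_raising (τ : ℂ) (x : g) : leftMul τ x ∈ raising 1 :=
  extendQuadratic_mem_raising (d := 0) (fun k r hr => mulMom_mem_Rgr x hr)
    (fun k r hr => by
      rw [add_zero]
      exact Submodule.smul_mem _ _ (bracket_mom_mem_Rgr x hr))
    (fun k r hr => secondOrder_mem_Rgr τ x hr)

/-- The `r ∈ R` for which some left multiplication raising the total degree by `d` maps `1` to
`r`. -/
def symbols (τ : ℂ) (d : ℤ) : Submodule ℂ R :=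
  ((Subalgebra.toSubmodule (leftAlg τ) ⊓ raising d).map (LinearMap.applyₗ (1 : R[X]))).comap
    ((Polynomial.monomial 0).restrictScalars ℂ)

theorem mem_symbols {τ : ℂ} {d : ℤ} {r : R} :
    r ∈ symbols τ d ↔ ∃ a, (a ∈ leftAlg τ ∧ a ∈ raising d) ∧ a 1 = Polynomial.C r := Iff.rfl

/- In `μ_x ⋆ r = μ_x r + (t/2) {μ_x, r} + t² (…)` all terms but `μ_x r` are known by induction to
be values of left multiplications. -/
theorem mom_mul_mem_symbols {τ : ℂ} {d : ℤ} {x : g} {r : R} (h₀ : r ∈ symbols τ d)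
    (h₁ : bracket (mom x) r ∈ symbols τ d) (h₂ : secondOrder τ x r ∈ symbols τ (d - 1)) :
    mom x * r ∈ symbols τ (d + 1) := by
  obtain ⟨a₀, ⟨ha₀, hd₀⟩, hr₀⟩ := mem_symbols.1 h₀
  obtain ⟨a₁, ⟨ha₁, hd₁⟩, hr₁⟩ := mem_symbols.1 h₁
  obtain ⟨a₂, ⟨ha₂, hd₂⟩, hr₂⟩ := mem_symbols.1 h₂
  have hX := mulX_mem_leftAlg τ
  refine mem_symbols.2 ⟨leftMul τ x * a₀ - (1 / 2 : ℂ) • (mulX * a₁) - mulX * (mulX * a₂),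
    ⟨sub_mem (sub_mem (mul_mem (leftMul_mem_leftAlg τ x) ha₀)
      ((leftAlg τ).smul_mem (mul_mem hX ha₁) _)) (mul_mem hX (mul_mem hX ha₂)), ?_⟩, ?_⟩
  · rw [add_comm d]
    refine sub_mem (sub_mem (mul_mem_raising (leftMul_mem_raising τ x) hd₀)
      (Submodule.smul_mem _ _ (mul_mem_raising mulX_mem_raising hd₁))) ?_
    rw [← add_sub_cancel 1 d]
    exact mul_mem_raising mulX_mem_raising (mul_mem_raising mulX_mem_raising hd₂)
  · simp only [LinearMap.sub_apply, LinearMap.smul_apply, Module.End.mul_apply, hr₀, hr₁, hr₂,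
      leftMul_C, mulX_apply, ← Polynomial.smul_C, mul_smul_comm]
    ring

theorem algebraMap_mem_symbols (τ c : ℂ) : algebraMap ℂ R c ∈ symbols τ 0 := by
  refine mem_symbols.2 ⟨algebraMap ℂ _ c, ⟨Subalgebra.algebraMap_mem _ c, fun n F hF => ?_⟩, ?_⟩
  · rw [Module.algebraMap_end_apply, add_zero]
    exact Submodule.smul_mem _ _ hF
  · rw [Module.algebraMap_end_apply, Algebra.algebraMap_eq_smul_one, ← Polynomial.C_1,
      Polynomial.smul_C]

theorem Rgr_le_symbols (τ : ℂ) (d : ℤ) : Rgr d ≤ symbols τ d := by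
  suffices h : ∀ k : ℕ, ∀ d : ℤ, d < k → Rgr d ≤ symbols τ d from
    h (d + 1).toNat d (by omega)
  clear d
  intro k
  induction k with
  | zero =>
    intro d hd
    rw [Rgr_of_neg (by simpa using hd)]
    exact bot_le
  | succ k ih =>
    intro d hd
    rcases (Int.lt_add_one_iff.1 (by simpa using hd)).lt_or_eq with hlt | rfl
    · exact ih d hlt
    rcases k with _ | k
    · rw [Nat.cast_zero, Rgr_zero]
      rintro _ hr
      obtain ⟨c, rfl⟩ := Submodule.mem_one.1 hr
      exact algebraMap_mem_symbols τ c
    rw [Rgr_natCast, pow_succ', Submodule.mul_le]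
    rintro _ ⟨x, rfl⟩ r hr
    rw [← Rgr_natCast] at hr
    rw [Nat.cast_succ]
    exact mom_mul_mem_symbols (ih k (by simp) hr) (ih k (by simp) (bracket_mom_mem_Rgr x hr))
      (ih (k - 1) (by omega) (secondOrder_mem_Rgr τ x hr))

theorem exists_mem_leftAlg_C (τ : ℂ) (r : R) : ∃ a ∈ leftAlg τ, a 1 = Polynomial.C r := by
  have htop : ((Subalgebra.toSubmodule (leftAlg τ)).map (LinearMap.applyₗ (1 : R[X]))).comap
      ((Polynomial.monomial 0).restrictScalars ℂ) = ⊤ :=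
    eq_top_of_Rgr_le fun k => (Rgr_le_symbols τ k).trans
      (Submodule.comap_mono (Submodule.map_mono inf_le_left))
  exact (Submodule.mem_comap.1 (htop ▸ Submodule.mem_top : r ∈ _) :)

theorem exists_mem_leftAlg (τ : ℂ) (F : R[X]) : ∃ a ∈ leftAlg τ, a 1 = F := by
  induction F using Polynomial.induction_on' with
  | add F G hF hG =>
    obtain ⟨a, ha, rfl⟩ := hF
    obtain ⟨a', ha', rfl⟩ := hG
    exact ⟨a + a', add_mem ha ha', rfl⟩
  | monomial n r =>
    obtain ⟨a, ha, h1⟩ := exists_mem_leftAlg_C τ r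
    refine ⟨mulX ^ n * a, mul_mem (pow_mem (mulX_mem_leftAlg τ) n) ha, ?_⟩
    rw [Module.End.mul_apply, h1, mulX, LinearMap.pow_mulLeft, LinearMap.mulLeft_apply, mul_comm,
      Polynomial.C_mul_X_pow_eq_monomial]

theorem isCyclicPair (τ : ℂ) : IsCyclicPair (leftAlg τ) (rightAlg τ) (1 : R[X]) where
  commute := leftAlg_commute_rightAlg τ
  exists_left := exists_mem_leftAlg τ
  exists_right F := by
    obtain ⟨F, rfl⟩ := (flip (K := ℂ)).surjective F
    obtain ⟨a, ha, rfl⟩ := exists_mem_leftAlg τ F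
    exact ⟨_, conj_flip_mem_rightAlg τ a ha, conjAlgEquiv_apply_of_apply_eq flip_one a⟩

/-- The operator `a` on `R[t]` is `F ↦ (r + t r') F + (t/2) {r, F}` modulo `t²`. -/
def HasSymbol (a : Module.End ℂ R[X]) (r r' : R) : Prop :=
  ∀ F : R[X], (a F).coeff 0 = r * F.coeff 0 ∧
    (a F).coeff 1 = r * F.coeff 1 + r' * F.coeff 0 + (1 / 2 : ℂ) • bracket r (F.coeff 0)

theorem hasSymbol_mulX : HasSymbol mulX 0 1 := fun F => by
  have h0 : bracket 0 (F.coeff 0) = 0 := rho_injective <| by simp [ham_apply]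
  simp [h0]

theorem hasSymbol_leftMul (τ : ℂ) (x : g) : HasSymbol (leftMul τ x) (mom x) 0 := fun F => by
  simp [leftMul, extendQuadratic, Polynomial.coeff_X_mul]

theorem hasSymbol_algebraMap (c : ℂ) : HasSymbol (algebraMap ℂ _ c) (algebraMap ℂ R c) 0 :=
  fun F => by
    have h0 : bracket (algebraMap ℂ R c) (F.coeff 0) = 0 := rho_injective <| by simp [ham_apply]
    simp [h0, Algebra.smul_def]

theorem HasSymbol.add {a₁ a₂ : Module.End ℂ R[X]} {r₁ r₁' r₂ r₂' : R} (h₁ : HasSymbol a₁ r₁ r₁')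
    (h₂ : HasSymbol a₂ r₂ r₂') : HasSymbol (a₁ + a₂) (r₁ + r₂) (r₁' + r₂') := fun F => by
  have hbracket : bracket (r₁ + r₂) (F.coeff 0) = bracket r₁ (F.coeff 0) + bracket r₂ (F.coeff 0) :=
    rho_injective <| by
      simp only [rho_bracket, ham_apply, map_add]
      ring
  simp only [LinearMap.add_apply, Polynomial.coeff_add, h₁ F, h₂ F, hbracket, smul_add]
  constructor <;> ring

theorem HasSymbol.mul {a₁ a₂ : Module.End ℂ R[X]} {r₁ r₁' r₂ r₂' : R} (h₁ : HasSymbol a₁ r₁ r₁')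
    (h₂ : HasSymbol a₂ r₂ r₂') :
    HasSymbol (a₁ * a₂) (r₁ * r₂) (r₁ * r₂' + r₁' * r₂ + (1 / 2 : ℂ) • bracket r₁ r₂) := fun F => by
  have hbracket : bracket (r₁ * r₂) (F.coeff 0) =
      r₁ * bracket r₂ (F.coeff 0) + r₂ * bracket r₁ (F.coeff 0) :=
    rho_injective <| by
      simp only [rho_bracket, ham_apply, map_add, map_mul, Derivation.leibniz, smul_eq_mul]
      ring
  simp only [Module.End.mul_apply, h₁ (a₂ F), h₂ F, bracket_mul, hbracket, Algebra.smul_def]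
  constructor <;> ring

theorem exists_hasSymbol {τ : ℂ} {a : Module.End ℂ R[X]} (ha : a ∈ leftAlg τ) :
    ∃ r r', HasSymbol a r r' := by
  induction ha using Algebra.adjoin_induction with
  | mem a ha =>
    rcases ha with rfl | ⟨x, rfl⟩
    exacts [⟨_, _, hasSymbol_mulX⟩, ⟨_, _, hasSymbol_leftMul τ x⟩]
  | algebraMap c => exact ⟨_, _, hasSymbol_algebraMap c⟩
  | add a b _ _ h₁ h₂ =>
    obtain ⟨_, _, h₁⟩ := h₁
    obtain ⟨_, _, h₂⟩ := h₂
    exact ⟨_, _, h₁.add h₂⟩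
  | mul a b _ _ h₁ h₂ =>
    obtain ⟨_, _, h₁⟩ := h₁
    obtain ⟨_, _, h₂⟩ := h₂
    exact ⟨_, _, h₁.mul h₂⟩

theorem exists_mem_leftAlg_hasSymbol (τ : ℂ) (r : R) :
    ∃ a ∈ leftAlg τ, a 1 = Polynomial.C r ∧ HasSymbol a r 0 := by
  obtain ⟨a, ha, h1⟩ := exists_mem_leftAlg τ (Polynomial.C r)
  obtain ⟨q, q', hq⟩ := exists_hasSymbol ha
  have h1q : bracket q (1 : R) = 0 := by rw [← map_one (algebraMap ℂ R), bracket_algebraMap]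
  obtain ⟨h0, h0'⟩ := hq 1
  obtain rfl : r = q := by simpa [h1] using h0
  obtain rfl : 0 = q' := by simpa [h1, h1q, Polynomial.coeff_one, Polynomial.coeff_C] using h0'
  exact ⟨a, ha, h1, hq⟩

theorem mul_coeff_zero (τ : ℂ) (r r' : R) :
    ((isCyclicPair τ).mul (Polynomial.C r) (Polynomial.C r')).coeff 0 = r * r' := by
  obtain ⟨a, ha, h1, hr⟩ := exists_mem_leftAlg_hasSymbol τ r
  rw [← h1, (isCyclicPair τ).mul_left ha, (hr _).1, Polynomial.coeff_C_zero]

theorem mul_coeff_one (τ : ℂ) (r r' : R) :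
    ((isCyclicPair τ).mul (Polynomial.C r) (Polynomial.C r')).coeff 1 =
      (1 / 2 : ℂ) • bracket r r' := by
  obtain ⟨a, ha, h1, hr⟩ := exists_mem_leftAlg_hasSymbol τ r
  rw [← h1, (isCyclicPair τ).mul_left ha, (hr _).2, Polynomial.coeff_C_zero,
    Polynomial.coeff_C_succ, mul_zero, zero_mul, zero_add, zero_add]

theorem bracket_skew (r r' : R) : bracket r' r = -bracket r r' :=
  rho_injective <| by
    simp only [rho_bracket, ham_apply, map_neg]
    ring

/-- The star product with parameter `τ`. -/
def starProduct (τ : ℂ) : StarProduct where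
  star := (isCyclicPair τ).mul
  X_star := (isCyclicPair τ).mul_apply_left (mulX_mem_leftAlg τ)
  star_X := (isCyclicPair τ).mul_apply_right (mulX_mem_rightAlg τ)
  assoc := (isCyclicPair τ).mul_assoc
  coeff_zero := mul_coeff_zero τ
  coeff_one a b := by
    rw [mul_coeff_one, mul_coeff_one, bracket_skew (proj a), smul_neg, sub_neg_eq_add, ← add_smul,
      add_halves, one_smul, bracket_proj]
  parity p r r' := by
    rw [← flip_C (K := ℂ) r, ← flip_C (K := ℂ) r',
      (isCyclicPair τ).mul_equiv flip flip_one (conj_flip_mem_rightAlg τ), flip_C, flip_C,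
      coeff_flip, Algebra.smul_def, map_pow, map_neg, map_one]
  graded p k l r hr r' hr' := by
    obtain ⟨a, ⟨ha, hd⟩, h1⟩ := mem_symbols.1 (Rgr_le_symbols τ k hr)
    rw [← h1, (isCyclicPair τ).mul_left ha, add_comm (k : ℤ)]
    exact hd l _ (C_mem_totalGr hr') p

theorem starProduct_star_mom (τ : ℂ) (x : g) (F : R[X]) :
    (starProduct τ).star (Polynomial.C (mom x)) F = leftMul τ x F := by
  rw [← leftMul_one τ x]
  exact DFunLike.congr_fun ((isCyclicPair τ).mul_left (leftMul_mem_leftAlg τ x)) F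

theorem starProduct_star_mom_right (τ : ℂ) (x : g) (F : R[X]) :
    (starProduct τ).star F (Polynomial.C (mom x)) = rightMul τ x F := by
  rw [← rightMul_one τ x]
  exact (isCyclicPair τ).mul_right (rightMul_mem_rightAlg τ x) F

theorem leftMul_sub_rightMul (τ : ℂ) (x : g) :
    leftMul τ x - rightMul τ x = mulX * extend (bracket (mom x)) := by
  rw [leftMul, rightMul, extendQuadratic_sub, ← sub_smul, sub_neg_eq_add, add_halves, one_smul]

theorem starProduct_isEquivariant (τ : ℂ) : (starProduct τ).IsEquivariant := fun x a => by
  rw [starProduct_star_mom, starProduct_star_mom_right, ← LinearMap.sub_apply,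
    leftMul_sub_rightMul, Module.End.mul_apply, extend_C, mulX_apply]
  exact congrArg (fun r => Polynomial.X * Polynomial.C r) (bracket_proj _ a)

/-- The value of the Casimir element `h² - 2h + 4ef` in the algebra of a star product. -/
def casimir (s : StarProduct) : R :=
  s.circ (mom h) (mom h) - (2 : ℂ) • mom h + (4 : ℂ) • s.circ (mom e) (mom f)

theorem diffTwo_quad (x y : g) :
    diffTwo x (quad y) = MvPolynomial.C (-1 / 2 * killingForm ℂ g x y) := by
  rw [map_mul, killingForm_eq, diffTwo_apply, quad_apply]
  simp only [map_add, map_sub, map_mul, map_ofNat, Derivation.leibniz,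
    Derivation.leibniz_pow, MvPolynomial.pderiv_C, derivation_two, smul_eq_mul, du_u, du_v, dv_u,
    dv_v, map_zero, Derivation.map_one_eq_zero, nsmul_eq_mul, Nat.cast_ofNat]
  linear_combination -(4 * (MvPolynomial.C (entry 0 0 x) * MvPolynomial.C (entry 0 0 y)) +
    2 * (MvPolynomial.C (entry 0 1 x) * MvPolynomial.C (entry 1 0 y) +
      MvPolynomial.C (entry 1 0 x) * MvPolynomial.C (entry 0 1 y))) * C_neg_half_mul_two

theorem secondOrder_mom (τ : ℂ) (x y : g) :
    secondOrder τ x (mom y) = algebraMap ℂ R ((τ - 4) / 96 * killingForm ℂ g x y) := by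
  have hcoeff : secondOrderCoeff τ 2 = (4 - τ) / 48 := by norm_num [secondOrderCoeff]
  apply rho_injective
  rw [rho_secondOrder τ x (k := 1) (mom_mem_Rgr y), rho_mom, diffTwo_quad, mul_one, hcoeff,
    AlgHom.commutes, MvPolynomial.algebraMap_eq, MvPolynomial.smul_eq_C_mul, ← map_mul]
  congr 1
  ring

theorem starProduct_circ_mom_mom (τ : ℂ) (x y : g) :
    (starProduct τ).circ (mom x) (mom y) = mom x * mom y + (1 / 2 : ℂ) • mom ⁅x, y⁆ +
      algebraMap ℂ R ((τ - 4) / 96 * killingForm ℂ g x y) := by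
  rw [StarProduct.circ, starProduct_star_mom, leftMul_C, bracket_mom_mom, secondOrder_mom]
  simp

theorem mom_h_sq_add : mom h * mom h + (4 : ℂ) • (mom e * mom f) = 0 :=
  rho_injective <| by
    rw [map_add, map_smul, map_mul, map_mul, rho_mom, rho_mom, rho_mom, quad_h, quad_e, quad_f,
      map_zero, MvPolynomial.smul_eq_C_mul, map_ofNat]
    ring

theorem casimir_starProduct (τ : ℂ) :
    casimir (starProduct τ) = algebraMap ℂ R (τ / 4 - 1) := by
  have hh : killingForm ℂ g h h = 8 := by simp [killingForm_eq, h]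
  have hef : killingForm ℂ g e f = 4 := by simp [killingForm_eq, f, e_eq]
  have hconst : τ / 4 - 1 = (τ - 4) / 96 * 8 + 4 * ((τ - 4) / 96 * 4) := by ring
  rw [casimir, starProduct_circ_mom_mom, starProduct_circ_mom_mom, lie_self, lie_e_f, hh, hef,
    hconst, map_add, map_mul _ 4, ← Algebra.smul_def, map_zero]
  linear_combination (norm := module) mom_h_sq_add

/-! ### The algebra of a star product -/

theorem monomial_eq_X_pow_mul_C {K : Type*} [CommSemiring K] (n : ℕ) (c : K) :
    Polynomial.monomial n c = Polynomial.X ^ n * Polynomial.C c := by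
  rw [mul_comm, Polynomial.C_mul_X_pow_eq_monomial]

namespace StarProduct

variable (s : StarProduct)

/-- The product `∘` as a bilinear map. -/
def circL : R →ₗ[ℂ] R →ₗ[ℂ] R :=
  (s.star.compl₁₂ ((Polynomial.monomial 0).restrictScalars ℂ : R →ₗ[ℂ] R[X])
    ((Polynomial.monomial 0).restrictScalars ℂ)).compr₂ ((Polynomial.leval 1).restrictScalars ℂ)

theorem circ_add (r r₁ r₂ : R) : s.circ r (r₁ + r₂) = s.circ r r₁ + s.circ r r₂ :=
  map_add (s.circL r) r₁ r₂

theorem add_circ (r₁ r₂ r : R) : s.circ (r₁ + r₂) r = s.circ r₁ r + s.circ r₂ r :=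
  s.circL.map_add₂ r₁ r₂ r

theorem X_pow_star (n : ℕ) (F G : R[X]) :
    s.star (Polynomial.X ^ n * F) G = Polynomial.X ^ n * s.star F G := by
  induction n with
  | zero => simp only [pow_zero, one_mul]
  | succ n ih => rw [pow_succ', mul_assoc, s.X_star, ih, mul_assoc]

theorem star_X_pow (n : ℕ) (F G : R[X]) :
    s.star F (Polynomial.X ^ n * G) = Polynomial.X ^ n * s.star F G := by
  induction n with
  | zero => simp only [pow_zero, one_mul]
  | succ n ih => rw [pow_succ', mul_assoc, s.star_X, ih, mul_assoc]

theorem ext_C {s s' : StarProduct} (h : ∀ r r' : R, s.star (Polynomial.C r) (Polynomial.C r') =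
    s'.star (Polynomial.C r) (Polynomial.C r')) : s = s' := by
  apply StarProduct.ext
  ext F G : 2
  induction F using Polynomial.induction_on' with
  | add F F' hF hF' => simp only [map_add, LinearMap.add_apply, hF, hF']
  | monomial n r =>
    induction G using Polynomial.induction_on' with
    | add G G' hG hG' => simp only [map_add, hG, hG']
    | monomial m r' => simp only [monomial_eq_X_pow_mul_C, X_pow_star, star_X_pow, h]

theorem eval_star (F G : R[X]) : (s.star F G).eval 1 = s.circ (F.eval 1) (G.eval 1) := by
  induction F using Polynomial.induction_on' with
  | add F F' hF hF' =>
    rw [map_add, LinearMap.add_apply, Polynomial.eval_add, Polynomial.eval_add, hF, hF', add_circ]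
  | monomial n r =>
    induction G using Polynomial.induction_on' with
    | add G G' hG hG' =>
      rw [map_add, Polynomial.eval_add, Polynomial.eval_add, hG, hG', circ_add]
    | monomial m r' =>
      simp only [monomial_eq_X_pow_mul_C, X_pow_star, star_X_pow, Polynomial.eval_mul,
        Polynomial.eval_pow, Polynomial.eval_X, one_pow, one_mul, Polynomial.eval_C, circ]

theorem circ_assoc (a b c : R) : s.circ (s.circ a b) c = s.circ a (s.circ b c) := by
  have h := congrArg (Polynomial.eval 1)
    (s.assoc (Polynomial.C a) (Polynomial.C b) (Polynomial.C c))
  simpa only [eval_star, Polynomial.eval_C] using h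

theorem star_coeff_zero (F G : R[X]) : (s.star F G).coeff 0 = F.coeff 0 * G.coeff 0 := by
  conv_lhs => rw [← Polynomial.X_mul_divX_add F, ← Polynomial.X_mul_divX_add G]
  rw [map_add, map_add, LinearMap.add_apply, s.X_star, s.star_X, LinearMap.add_apply, s.X_star]
  simp [s.coeff_zero, s.star_X]

theorem one_star_one : s.star 1 1 = 1 := by
  have h1 : (1 : R) ∈ Rgr (0 : ℕ) := by
    rw [Nat.cast_zero, Rgr_zero]
    exact Submodule.mem_one.2 ⟨1, map_one _⟩
  ext p
  rcases p with _ | p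
  · simp [star_coeff_zero]
  · have hp := s.graded (p + 1) 0 0 1 h1 1 h1
    rw [Rgr_of_neg (by push_cast; omega), Submodule.mem_bot, Polynomial.C_1] at hp
    rw [hp, Polynomial.coeff_one, if_neg p.succ_ne_zero]

theorem eq_zero_of_star_one {F : R[X]} (hF : s.star F 1 = 0) : F = 0 := by
  ext p
  have h0 {F : R[X]} (hF : s.star F 1 = 0) : F.coeff 0 = 0 := by
    simpa [hF] using (s.star_coeff_zero F 1).symm
  induction p generalizing F with
  | zero => exact h0 hF
  | succ p ih =>
    obtain ⟨G, rfl⟩ := Polynomial.X_dvd_iff.2 (h0 hF)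
    rw [s.X_star, Polynomial.isRegular_X.left.mul_left_eq_zero_iff] at hF
    rw [Polynomial.coeff_X_mul, ih hF, Polynomial.coeff_zero, Polynomial.coeff_zero]

theorem star_one (F : R[X]) : s.star F 1 = F :=
  sub_eq_zero.1 <| s.eq_zero_of_star_one <| by
    rw [map_sub, LinearMap.sub_apply, s.assoc, one_star_one, sub_self]

theorem one_star_C (r : R) : s.star 1 (Polynomial.C r) = Polynomial.C r := by
  ext p
  rw [← Polynomial.C_1, s.parity, Polynomial.C_1, star_one]
  rcases p with _ | p
  · rw [pow_zero, one_mul]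
  · rw [Polynomial.coeff_C_succ, mul_zero]

theorem circ_one (r : R) : s.circ r 1 = r := by
  rw [circ, Polynomial.C_1, star_one, Polynomial.eval_C]

theorem one_circ (r : R) : s.circ 1 r = r := by
  rw [circ, Polynomial.C_1, one_star_C, Polynomial.eval_C]

theorem circ_sub_circ {s : StarProduct} (hs : s.IsEquivariant) (x : g) (r : R) :
    s.circ (mom x) r - s.circ r (mom x) = bracket (mom x) r := by
  obtain ⟨a, rfl⟩ := proj_surjective r
  have h := congrArg (Polynomial.eval 1) (hs x a)
  rw [Polynomial.eval_sub, Polynomial.eval_mul, Polynomial.eval_X, one_mul,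
    Polynomial.eval_C] at h
  exact h.trans (bracket_proj _ a).symm

/-- The vector space `R` with the product `∘` of the star product. -/
def Circ (_ : StarProduct) : Type := R

instance : AddCommGroup s.Circ := inferInstanceAs (AddCommGroup R)

instance : Module ℂ s.Circ := inferInstanceAs (Module ℂ R)

instance : Ring s.Circ where
  __ := (inferInstance : AddCommGroup s.Circ)
  mul := s.circ
  one := (1 : R)
  left_distrib := s.circ_add
  right_distrib := s.add_circ
  zero_mul := s.circL.map_zero₂
  mul_zero r := map_zero (s.circL r)
  mul_assoc := s.circ_assoc
  one_mul := s.one_circ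
  mul_one := s.circ_one

instance : Algebra ℂ s.Circ :=
  Algebra.ofModule (A := s.Circ) s.circL.map_smul₂ fun c r => map_smul (s.circL r) c

/-- The identity map from the algebra of a star product to `R`. -/
def ofCirc : s.Circ ≃ₗ[ℂ] R := LinearEquiv.refl ℂ R

theorem ofCirc_mul (a b : s.Circ) : s.ofCirc (a * b) = s.circ (s.ofCirc a) (s.ofCirc b) := rfl

theorem ofCirc_one : s.ofCirc 1 = 1 := rfl

variable {s} (hs : s.IsEquivariant)

/-- The homomorphism `Ψ : U(𝔤) → (R, ∘)`. -/
def psiHom : U →ₐ[ℂ] s.Circ :=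
  UniversalEnvelopingAlgebra.lift ℂ
    { toLinearMap := s.ofCirc.symm.toLinearMap ∘ₗ mom
      map_lie' {x y} := s.ofCirc.injective <| by
        rw [LieRing.of_associative_ring_bracket, map_sub, ofCirc_mul, ofCirc_mul]
        exact (bracket_mom_mom x y).symm.trans (circ_sub_circ hs x (mom y)).symm }

/-- The homomorphism `Ψ : U(𝔤) → (R, ∘)`, as a map to `R`. -/
def psi : U →ₗ[ℂ] R := s.ofCirc.toLinearMap ∘ₗ (psiHom hs).toLinearMap

theorem psi_one : psi hs 1 = 1 := congrArg s.ofCirc (map_one (psiHom hs))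

theorem psi_mul (w w' : U) : psi hs (w * w') = s.circ (psi hs w) (psi hs w') :=
  congrArg s.ofCirc (map_mul (psiHom hs) w w')

theorem psi_ι (x : g) : psi hs (UniversalEnvelopingAlgebra.ι ℂ x) = mom x :=
  congrArg s.ofCirc (UniversalEnvelopingAlgebra.lift_ι_apply ℂ _ x)

theorem psi_algebraMap (c : ℂ) : psi hs (algebraMap ℂ U c) = algebraMap ℂ R c := by
  rw [Algebra.algebraMap_eq_smul_one, map_smul, psi_one, Algebra.algebraMap_eq_smul_one]

theorem psi_lie (x : g) (w : U) :
    psi hs ⁅UniversalEnvelopingAlgebra.ι ℂ x, w⁆ = bracket (mom x) (psi hs w) := by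
  rw [LieRing.of_associative_ring_bracket, map_sub, psi_mul, psi_mul, psi_ι, circ_sub_circ hs]

theorem eq_psi {Ψ : U →ₗ[ℂ] R} (h1 : Ψ 1 = 1)
    (hmul : ∀ w w', Ψ (w * w') = s.circ (Ψ w) (Ψ w'))
    (hι : ∀ x : g, Ψ (UniversalEnvelopingAlgebra.ι ℂ x) = mom x) : Ψ = psi hs := by
  let Ψ' : U →ₐ[ℂ] s.Circ := AlgHom.ofLinearMap (s.ofCirc.symm.toLinearMap ∘ₗ Ψ) h1 hmul
  have hΨ' : Ψ' = psiHom hs := UniversalEnvelopingAlgebra.hom_ext ℂ <| LieHom.ext fun x =>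
    (hι x).trans (psi_ι hs x).symm
  exact LinearMap.ext fun w => congrArg s.ofCirc (DFunLike.congr_fun hΨ' w)

end StarProduct

/-! ### Leading terms -/

/-- The filtration of `R` induced by the grading, shifted by one: sums of homogeneous elements of
degree less than `n`. -/
def below (n : ℕ) : Submodule ℂ R := ⨆ k : Fin n, Rgr (k : ℕ)

theorem Rgr_le_below {d : ℤ} {n : ℕ} (hd : d < n) : Rgr d ≤ below n := by
  rcases lt_or_ge d 0 with h0 | h0
  · rw [Rgr_of_neg h0]
    exact bot_le
  · lift d to ℕ using h0
    exact le_iSup (fun k : Fin n => Rgr (k : ℕ)) ⟨d, by exact_mod_cast hd⟩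

theorem below_le {n : ℕ} {M : Submodule ℂ R} (hM : ∀ k : ℕ, k < n → Rgr k ≤ M) : below n ≤ M :=
  iSup_le fun k => hM k k.isLt

theorem below_mono {n n' : ℕ} (hn : n ≤ n') : below n ≤ below n' :=
  below_le fun _ hk => Rgr_le_below (by exact_mod_cast hk.trans_le hn)

theorem coeff_rho_eq_zero_of_mem_below {n : ℕ} {r : R} (hr : r ∈ below n) {m : Fin 2 →₀ ℕ}
    (hm : 2 * n ≤ m.degree) : (rho r).coeff m = 0 := by
  suffices h : below n ≤ LinearMap.ker (MvPolynomial.lcoeff ℂ m ∘ₗ rho.toLinearMap) from h hr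
  exact below_le fun k hk r hr => ((mem_Rgr_iff k r).1 hr).coeff_eq_zero (by omega)

theorem mom_mul_mem_below (x : g) {n : ℕ} {r : R} (hr : r ∈ below n) :
    mom x * r ∈ below (n + 1) := by
  suffices h : below n ≤ (below (n + 1)).comap (mulMom x) from h hr
  exact below_le fun k hk r hr => Rgr_le_below (by push_cast; omega) (mulMom_mem_Rgr x hr)

theorem prod_mom_mem_Rgr (l : List g) : (l.map mom).prod ∈ Rgr l.length := by
  induction l with
  | nil =>
    rw [List.length_nil, Nat.cast_zero, Rgr_zero]
    exact Submodule.one_le.1 le_rfl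
  | cons x l ih =>
    rw [List.map_cons, List.prod_cons, List.length_cons, Nat.cast_succ]
    exact mulMom_mem_Rgr x ih

namespace StarProduct

theorem circ_mom_sub_mul_mem_below (s : StarProduct) (x : g) {n : ℕ} {r : R} (hr : r ∈ below n) :
    s.circ (mom x) r - mom x * r ∈ below n := by
  suffices h : below n ≤ (below n).comap (s.circL (mom x) - mulMom x) from h hr
  refine below_le fun k hk r hr => ?_
  change s.circ (mom x) r - mom x * r ∈ below n
  rw [circ, Polynomial.eval_eq_sum_range, Finset.sum_range_succ', s.coeff_zero, pow_zero, mul_one,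
    add_sub_cancel_right]
  refine sum_mem fun p _ => ?_
  rw [one_pow, mul_one]
  exact Rgr_le_below (by push_cast; omega) (s.graded (p + 1) 1 k _ (mom_mem_Rgr x) _ hr)

theorem psi_prod_sub_mem_below {s : StarProduct} (hs : s.IsEquivariant) (l : List g) :
    psi hs (l.map (UniversalEnvelopingAlgebra.ι ℂ)).prod - (l.map mom).prod ∈ below l.length := by
  induction l with
  | nil => simp only [List.map_nil, List.prod_nil, psi_one, sub_self, zero_mem]
  | cons x l ih =>
    rw [List.map_cons, List.prod_cons, List.map_cons, List.prod_cons, List.length_cons, psi_mul,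
      psi_ι]
    set w := psi hs (l.map (UniversalEnvelopingAlgebra.ι ℂ)).prod
    have hw : w ∈ below (l.length + 1) := by
      rw [← sub_add_cancel w]
      exact add_mem (below_mono (Nat.le_succ _) ih)
        (Rgr_le_below (by push_cast; omega) (prod_mom_mem_Rgr l))
    rw [← sub_add_sub_cancel _ (mom x * w), ← mul_sub]
    exact add_mem (circ_mom_sub_mul_mem_below s x hw) (mom_mul_mem_below x ih)

end StarProduct

/-! ### Ordered monomials at most linear in `h` -/

section Words

variable {Q : Type*} [Ring Q] [Algebra ℂ Q] {E H F : Q}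

theorem mul_pow_of_weight (hHE : H * E = E * H + (2 : ℂ) • E) (i : ℕ) :
    H * E ^ i = E ^ i * H + (2 * i : ℂ) • E ^ i := by
  induction i with
  | zero => simp
  | succ i ih =>
    rw [pow_succ, ← mul_assoc, ih, add_mul, mul_assoc, hHE, mul_add, smul_mul_assoc, mul_smul_comm,
      ← mul_assoc]
    push_cast
    module

theorem lowering_mul_pow (hHE : H * E = E * H + (2 : ℂ) • E) (hFE : F * E = E * F - H) (i : ℕ) :
    F * E ^ i =
      E ^ i * F - (i : ℂ) • (E ^ (i - 1) * H) - (i * (i - 1) : ℂ) • E ^ (i - 1) := by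
  induction i with
  | zero => simp
  | succ i ih =>
    have hpow : (i : ℂ) • (E * E ^ (i - 1)) = (i : ℂ) • E ^ i := by
      rcases i with _ | i
      · simp
      · rw [Nat.add_sub_cancel, pow_succ']
    rw [pow_succ', ← mul_assoc, hFE, sub_mul, mul_assoc, ih, mul_pow_of_weight hHE, mul_sub,
      mul_sub, mul_smul_comm, mul_smul_comm, ← mul_assoc, ← mul_assoc, mul_comm (i : ℂ) (i - 1),
      mul_smul, hpow, ← smul_mul_assoc, hpow, Nat.add_sub_cancel, smul_mul_assoc]
    push_cast
    module

/-- The span of the ordered monomials in `E`, `H`, `F` that are at most linear in `H`. -/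
def wordSpan (E H F : Q) : Submodule ℂ Q :=
  Submodule.span ℂ (Set.range fun d : ℕ × Fin 2 × ℕ => E ^ d.1 * H ^ (d.2.1 : ℕ) * F ^ d.2.2)

theorem pow_mul_pow_mem_wordSpan (E H F : Q) (i j : ℕ) : E ^ i * F ^ j ∈ wordSpan E H F :=
  Submodule.subset_span ⟨(i, 0, j), by simp⟩

theorem pow_mul_mul_pow_mem_wordSpan (E H F : Q) (i j : ℕ) : E ^ i * H * F ^ j ∈ wordSpan E H F :=
  Submodule.subset_span ⟨(i, 1, j), by simp⟩

theorem mul_mem_wordSpan_of_forall {a z : Q} (h0 : ∀ i j : ℕ, a * E ^ i * F ^ j ∈ wordSpan E H F)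
    (h1 : ∀ i j : ℕ, a * E ^ i * H * F ^ j ∈ wordSpan E H F) (hz : z ∈ wordSpan E H F) :
    a * z ∈ wordSpan E H F := by
  suffices h : wordSpan E H F ≤ (wordSpan E H F).comap (LinearMap.mulLeft ℂ a) from h hz
  refine Submodule.span_le.2 ?_
  rintro _ ⟨⟨i, n, j⟩, rfl⟩
  fin_cases n
  · simpa [mul_assoc] using h0 i j
  · simpa [mul_assoc] using h1 i j

theorem raising_mul_mem_wordSpan {z : Q} (hz : z ∈ wordSpan E H F) : E * z ∈ wordSpan E H F := by
  refine mul_mem_wordSpan_of_forall (fun i j => ?_) (fun i j => ?_) hz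
  · rw [← pow_succ']
    exact pow_mul_pow_mem_wordSpan E H F (i + 1) j
  · rw [← pow_succ']
    exact pow_mul_mul_pow_mem_wordSpan E H F (i + 1) j

variable {c : ℂ}

theorem pow_mul_sq_mul_pow_mem_wordSpan
    (hc : H * H = c • 1 + (2 : ℂ) • H - (4 : ℂ) • (E * F)) (i j : ℕ) :
    E ^ i * H * H * F ^ j ∈ wordSpan E H F := by
  have hword : E ^ i * H * H * F ^ j = c • (E ^ i * F ^ j) + (2 : ℂ) • (E ^ i * H * F ^ j) -
      (4 : ℂ) • (E ^ (i + 1) * F ^ (j + 1)) := by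
    rw [mul_assoc (E ^ i), hc, pow_succ, pow_succ']
    simp only [mul_add, mul_sub, add_mul, sub_mul, mul_smul_comm, smul_mul_assoc, mul_one,
      mul_assoc]
  rw [hword]
  exact sub_mem (add_mem (Submodule.smul_mem _ _ (pow_mul_pow_mem_wordSpan E H F i j))
    (Submodule.smul_mem _ _ (pow_mul_mul_pow_mem_wordSpan E H F i j)))
    (Submodule.smul_mem _ _ (pow_mul_pow_mem_wordSpan E H F (i + 1) (j + 1)))

theorem weight_mul_mem_wordSpan (hHE : H * E = E * H + (2 : ℂ) • E)
    (hc : H * H = c • 1 + (2 : ℂ) • H - (4 : ℂ) • (E * F)) {z : Q} (hz : z ∈ wordSpan E H F) :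
    H * z ∈ wordSpan E H F := by
  refine mul_mem_wordSpan_of_forall (fun i j => ?_) (fun i j => ?_) hz
  · rw [mul_pow_of_weight hHE, add_mul, smul_mul_assoc]
    exact add_mem (pow_mul_mul_pow_mem_wordSpan E H F i j)
      (Submodule.smul_mem _ _ (pow_mul_pow_mem_wordSpan E H F i j))
  · rw [mul_pow_of_weight hHE, add_mul, add_mul, smul_mul_assoc, smul_mul_assoc]
    exact add_mem (pow_mul_sq_mul_pow_mem_wordSpan hc i j)
      (Submodule.smul_mem _ _ (pow_mul_mul_pow_mem_wordSpan E H F i j))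

theorem lowering_mul_mem_wordSpan (hHE : H * E = E * H + (2 : ℂ) • E) (hFE : F * E = E * F - H)
    (hFH : F * H = H * F + (2 : ℂ) • F)
    (hc : H * H = c • 1 + (2 : ℂ) • H - (4 : ℂ) • (E * F)) {z : Q} (hz : z ∈ wordSpan E H F) :
    F * z ∈ wordSpan E H F := by
  refine mul_mem_wordSpan_of_forall (fun i j => ?_) (fun i j => ?_) hz
  · rw [lowering_mul_pow hHE hFE, sub_mul, sub_mul, mul_assoc _ F, ← pow_succ', smul_mul_assoc,
      smul_mul_assoc]
    exact sub_mem (sub_mem (pow_mul_pow_mem_wordSpan E H F i (j + 1))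
      (Submodule.smul_mem _ _ (pow_mul_mul_pow_mem_wordSpan E H F (i - 1) j)))
      (Submodule.smul_mem _ _ (pow_mul_pow_mem_wordSpan E H F (i - 1) j))
  · have hword : E ^ i * F * H * F ^ j =
        E ^ i * H * F ^ (j + 1) + (2 : ℂ) • (E ^ i * F ^ (j + 1)) := by
      rw [mul_assoc (E ^ i), hFH, pow_succ']
      simp only [mul_add, add_mul, mul_smul_comm, smul_mul_assoc, mul_assoc]
    rw [lowering_mul_pow hHE hFE, sub_mul, sub_mul, sub_mul, sub_mul, hword]
    simp only [smul_mul_assoc]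
    exact sub_mem (sub_mem (add_mem (pow_mul_mul_pow_mem_wordSpan E H F i (j + 1))
      (Submodule.smul_mem _ _ (pow_mul_pow_mem_wordSpan E H F i (j + 1))))
      (Submodule.smul_mem _ _ (pow_mul_sq_mul_pow_mem_wordSpan hc (i - 1) j)))
      (Submodule.smul_mem _ _ (pow_mul_mul_pow_mem_wordSpan E H F (i - 1) j))

end Words

/-- The image of `e` in `U(𝔤)`. -/
def eU : U := UniversalEnvelopingAlgebra.ι ℂ e

/-- The image of `h` in `U(𝔤)`. -/
def hU : U := UniversalEnvelopingAlgebra.ι ℂ h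

/-- The image of `f` in `U(𝔤)`. -/
def fU : U := UniversalEnvelopingAlgebra.ι ℂ f

theorem hU_mul_eU : hU * eU = eU * hU + (2 : ℂ) • eU := by
  have hlie := LieHom.map_lie (UniversalEnvelopingAlgebra.ι ℂ) h e
  rw [lie_h_e, map_smul, LieRing.of_associative_ring_bracket] at hlie
  exact eq_add_of_sub_eq' hlie.symm

theorem fU_mul_eU : fU * eU = eU * fU - hU := by
  have hlie := LieHom.map_lie (UniversalEnvelopingAlgebra.ι ℂ) e f
  rw [lie_e_f, LieRing.of_associative_ring_bracket] at hlie
  exact eq_sub_of_add_eq' (eq_add_of_sub_eq hlie.symm).symm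

theorem fU_mul_hU : fU * hU = hU * fU + (2 : ℂ) • fU := by
  have hlie := LieHom.map_lie (UniversalEnvelopingAlgebra.ι ℂ) h f
  rw [lie_h_f, map_smul, LieRing.of_associative_ring_bracket, neg_smul] at hlie
  exact (neg_add_eq_iff_eq_add.1 (eq_sub_iff_add_eq.1 hlie)).trans (add_comm _ _)

/-- The Casimir element `h² - 2h + 4ef` of `U(𝔤)`. -/
def casU : U := hU * hU - (2 : ℂ) • hU + (4 : ℂ) • (eU * fU)

/-- The ordered monomials of `U(𝔤)` that are at most linear in `h`: a complement of the ideal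
generated by `casU - c`, for each scalar `c`. -/
def word (d : ℕ × Fin 2 × ℕ) : U := eU ^ d.1 * hU ^ (d.2.1 : ℕ) * fU ^ d.2.2

theorem mem_of_ι_mem {A : Subalgebra ℂ U} (hA : ∀ x : g, UniversalEnvelopingAlgebra.ι ℂ x ∈ A)
    (w : U) : w ∈ A := by
  let φ : g →ₗ⁅ℂ⁆ A :=
    { toFun x := ⟨UniversalEnvelopingAlgebra.ι ℂ x, hA x⟩
      map_add' x y := Subtype.ext (map_add _ x y)
      map_smul' c x := Subtype.ext (map_smul _ c x)
      map_lie' {x y} := Subtype.ext (LieHom.map_lie _ x y) }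
  have hφ : A.val.comp (UniversalEnvelopingAlgebra.lift ℂ φ) = AlgHom.id ℂ U :=
    UniversalEnvelopingAlgebra.hom_ext ℂ <| LieHom.ext fun x =>
      congrArg Subtype.val (UniversalEnvelopingAlgebra.lift_ι_apply ℂ φ x)
  rw [← AlgHom.id_apply (R := ℂ) w, ← hφ]
  exact (UniversalEnvelopingAlgebra.lift ℂ φ w).2

/-- The elements of an algebra that stabilize a subspace under left multiplication. -/
def leftStabilizer {Q : Type*} [Ring Q] [Algebra ℂ Q] (N : Submodule ℂ Q) : Subalgebra ℂ Q where
  carrier := {a | ∀ z ∈ N, a * z ∈ N}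
  mul_mem' {a b} ha hb z hz := mul_assoc a b z ▸ ha _ (hb z hz)
  add_mem' {a b} ha hb z hz := add_mul a b z ▸ add_mem (ha z hz) (hb z hz)
  algebraMap_mem' c z hz := Algebra.smul_def c z ▸ N.smul_mem c hz

theorem map_mem_span_word {Q : Type*} [Ring Q] [Algebra ℂ Q] (Θ : U →ₐ[ℂ] Q) {c : ℂ}
    (hΘ : Θ casU = algebraMap ℂ Q c) (w : U) :
    Θ w ∈ Submodule.span ℂ (Set.range fun d => Θ (word d)) := by
  have hspan : Submodule.span ℂ (Set.range fun d => Θ (word d)) =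
      wordSpan (Θ eU) (Θ hU) (Θ fU) := by
    simp only [word, map_mul, map_pow, wordSpan]
  have hHE : Θ hU * Θ eU = Θ eU * Θ hU + (2 : ℂ) • Θ eU := by
    rw [← map_mul, hU_mul_eU, map_add, map_mul, map_smul]
  have hFE : Θ fU * Θ eU = Θ eU * Θ fU - Θ hU := by
    rw [← map_mul, fU_mul_eU, map_sub, map_mul]
  have hFH : Θ fU * Θ hU = Θ hU * Θ fU + (2 : ℂ) • Θ fU := by
    rw [← map_mul, fU_mul_hU, map_add, map_mul, map_smul]
  have hc : Θ hU * Θ hU = c • 1 + (2 : ℂ) • Θ hU - (4 : ℂ) • (Θ eU * Θ fU) := by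
    rw [← Algebra.algebraMap_eq_smul_one, ← hΘ, casU]
    simp only [map_add, map_sub, map_mul, map_smul]
    abel
  have hι (x : g) : UniversalEnvelopingAlgebra.ι ℂ x ∈
      (leftStabilizer (wordSpan (Θ eU) (Θ hU) (Θ fU))).comap Θ := fun z hz => by
    change Θ _ * z ∈ wordSpan (Θ eU) (Θ hU) (Θ fU)
    rw [eq_combination x]
    simp only [map_add, map_smul, add_mul, smul_mul_assoc]
    exact add_mem (add_mem (Submodule.smul_mem _ _ (raising_mul_mem_wordSpan hz))
      (Submodule.smul_mem _ _ (weight_mul_mem_wordSpan hHE hc hz)))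
      (Submodule.smul_mem _ _ (lowering_mul_mem_wordSpan hHE hFE hFH hc hz))
  have h1 : (1 : Q) ∈ wordSpan (Θ eU) (Θ hU) (Θ fU) := by
    simpa only [pow_zero, mul_one] using pow_mul_pow_mem_wordSpan (Θ eU) (Θ hU) (Θ fU) 0 0
  rw [hspan, ← mul_one (Θ w)]
  exact mem_of_ι_mem hι w 1 h1

/-! ### The kernel of `Ψ` -/

/-- The exponent of the leading monomial of `word d`, as a function on the plane. -/
def leadingExponent (d : ℕ × Fin 2 × ℕ) : Fin 2 →₀ ℕ :=
  Finsupp.single 0 (2 * d.2.2 + d.2.1) + Finsupp.single 1 (2 * d.1 + d.2.1)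

/-- The number of factors of `word d`. -/
def wordLength (d : ℕ × Fin 2 × ℕ) : ℕ := d.1 + d.2.1 + d.2.2

theorem leadingExponent_zero (d : ℕ × Fin 2 × ℕ) : leadingExponent d 0 = 2 * d.2.2 + d.2.1 := by
  simp [leadingExponent]

theorem leadingExponent_one (d : ℕ × Fin 2 × ℕ) : leadingExponent d 1 = 2 * d.1 + d.2.1 := by
  simp [leadingExponent]

theorem degree_leadingExponent (d : ℕ × Fin 2 × ℕ) :
    (leadingExponent d).degree = 2 * wordLength d := by
  rw [Finsupp.degree_eq_sum, Fin.sum_univ_two, leadingExponent_zero, leadingExponent_one,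
    wordLength]
  ring

theorem leadingExponent_injective : Function.Injective leadingExponent := by
  intro d d' hd
  have h0 := DFunLike.congr_fun hd 0
  have h1 := DFunLike.congr_fun hd 1
  rw [leadingExponent_zero, leadingExponent_zero] at h0
  rw [leadingExponent_one, leadingExponent_one] at h1
  have := d.2.1.isLt
  have := d'.2.1.isLt
  ext <;> omega

/-- The coefficient of the leading monomial of `word d`. -/
def leadingCoefficient (d : ℕ × Fin 2 × ℕ) : ℂ := (-1) ^ d.1 * (-2) ^ (d.2.1 : ℕ)

theorem leadingCoefficient_ne_zero (d : ℕ × Fin 2 × ℕ) : leadingCoefficient d ≠ 0 := by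
  simp [leadingCoefficient]

namespace StarProduct

variable {s : StarProduct} (hs : s.IsEquivariant)

theorem coeff_rho_psi_word (d : ℕ × Fin 2 × ℕ) {m : Fin 2 →₀ ℕ} (hm : 2 * wordLength d ≤ m.degree) :
    (rho (psi hs (word d))).coeff m =
      (MvPolynomial.monomial (leadingExponent d) (leadingCoefficient d)).coeff m := by
  have hlead := psi_prod_sub_mem_below hs
    (List.replicate d.1 e ++ List.replicate d.2.1 h ++ List.replicate d.2.2 f)
  simp only [List.map_append, List.map_replicate, List.prod_append, List.prod_replicate,
    List.length_append, List.length_replicate] at hlead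
  have hcoeff := coeff_rho_eq_zero_of_mem_below hlead hm
  rw [map_sub, MvPolynomial.coeff_sub, sub_eq_zero] at hcoeff
  refine hcoeff.trans (congrArg (MvPolynomial.coeff m) ?_)
  rw [← mul_one (leadingCoefficient d), ← MvPolynomial.C_mul_monomial, monomial_one_fin_two,
    leadingExponent_zero, leadingExponent_one, leadingCoefficient]
  simp only [map_mul, map_pow, rho_mom, quad_e, quad_h, quad_f, map_neg, map_one, map_ofNat]
  rw [neg_pow (v ^ 2), neg_pow (2 * u * v), neg_pow (2 : P)]
  ring

theorem linearIndependent_psi_word : LinearIndependent ℂ fun d => psi hs (word d) := by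
  rw [linearIndependent_iff]
  intro l hl
  by_contra h0
  obtain ⟨d, hd, hmax⟩ :=
    Finset.exists_max_image l.support wordLength (Finsupp.support_nonempty_iff.2 h0)
  have hcoeff := congrArg (fun r => (rho r).coeff (leadingExponent d)) hl
  simp only [Finsupp.linearCombination_apply, Finsupp.sum, map_sum, MvPolynomial.coeff_sum,
    map_smul, MvPolynomial.coeff_smul, map_zero, MvPolynomial.coeff_zero] at hcoeff
  rw [Finset.sum_eq_single d] at hcoeff
  · rw [coeff_rho_psi_word hs d (degree_leadingExponent d).ge, MvPolynomial.coeff_monomial,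
      if_pos rfl, smul_eq_mul] at hcoeff
    exact mul_ne_zero (Finsupp.mem_support_iff.1 hd) (leadingCoefficient_ne_zero d) hcoeff
  · intro d' hd' hne
    rw [coeff_rho_psi_word hs d'
        (by rw [degree_leadingExponent]; exact Nat.mul_le_mul_left 2 (hmax d' hd')),
      MvPolynomial.coeff_monomial, if_neg (leadingExponent_injective.ne hne), smul_zero]
  · exact fun h => absurd hd h

theorem psi_casU : psi hs casU = casimir s := by
  simp only [casU, map_add, map_sub, map_smul, psi_mul, hU, eU, fU, psi_ι, casimir]

theorem psiHom_casU {c : ℂ} (hc : casimir s = algebraMap ℂ R c) :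
    psiHom hs casU = algebraMap ℂ s.Circ c := by
  apply s.ofCirc.injective
  rw [Algebra.algebraMap_eq_smul_one, map_smul, ofCirc_one, ← Algebra.algebraMap_eq_smul_one, ← hc]
  exact psi_casU hs

theorem map_eq_zero_of_psi_eq_zero {c : ℂ} (hc : casimir s = algebraMap ℂ R c) {Q : Type*} [Ring Q]
    [Algebra ℂ Q] (φ : U →ₐ[ℂ] Q) (hφ : φ casU = algebraMap ℂ Q c) {w : U} (hw : psi hs w = 0) :
    φ w = 0 := by
  obtain ⟨l, hl⟩ := Finsupp.mem_span_range_iff_exists_finsupp.1 <|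
    map_mem_span_word (φ.prod (psiHom hs)) (Prod.ext hφ (psiHom_casU hs hc)) w
  have hl2 : Finsupp.linearCombination ℂ (fun d => psi hs (word d)) l = 0 := by
    have hsnd := congrArg (s.ofCirc ∘ Prod.snd) hl
    simp only [Function.comp_apply, Finsupp.sum, Prod.snd_sum, map_sum, Prod.smul_snd, map_smul,
      AlgHom.prod_apply] at hsnd
    exact hsnd.trans hw
  rw [linearIndependent_iff.1 (linearIndependent_psi_word hs) l hl2, Finsupp.sum_zero_index] at hl
  exact (congrArg Prod.fst hl).symm

end StarProduct

/-! ### Uniqueness -/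

theorem ham_quad_e (F : P) : ham (quad e) F = -(v * du F) := by simp [ham_quad, e_eq]

theorem ham_quad_h (F : P) : ham (quad h) F = v * dv F - u * du F := by simp [ham_quad, h]

theorem ham_quad_f (F : P) : ham (quad f) F = -(u * dv F) := by simp [ham_quad, f]

theorem coeff_X_mul_pderiv {σ K : Type*} [CommSemiring K] (i : σ) (F : MvPolynomial σ K)
    (m : σ →₀ ℕ) :
    (MvPolynomial.X i * MvPolynomial.pderiv i F).coeff m = m i * F.coeff m := by
  classical
  induction F using MvPolynomial.induction_on' with
  | monomial m' c =>
    rw [MvPolynomial.X_mul_pderiv_monomial, nsmul_eq_mul, ← map_natCast MvPolynomial.C,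
      MvPolynomial.coeff_C_mul, MvPolynomial.coeff_monomial]
    split_ifs with h
    · rw [h]
    · rw [mul_zero, mul_zero]
  | add F G hF hG =>
    rw [map_add, mul_add, MvPolynomial.coeff_add, hF, hG, MvPolynomial.coeff_add, mul_add]

theorem coeff_ham_quad_h (F : P) (m : Fin 2 →₀ ℕ) :
    (ham (quad h) F).coeff m = ((m 1 : ℂ) - m 0) * F.coeff m := by
  rw [ham_quad_h, MvPolynomial.coeff_sub, coeff_X_mul_pderiv, coeff_X_mul_pderiv, sub_mul]

theorem eq_zero_of_mem_below_of_bracket_mom_h {k : ℕ} {r : R} (hr : r ∈ below k)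
    (hh : bracket (mom h) r = (2 * k : ℂ) • r) : r = 0 := by
  apply rho_injective
  ext m
  rw [map_zero, MvPolynomial.coeff_zero]
  rcases le_or_gt (2 * k) m.degree with hm | hm
  · exact coeff_rho_eq_zero_of_mem_below hr hm
  · have hcoeff := congrArg (fun r => (rho r).coeff m) hh
    simp only [rho_bracket, rho_mom, coeff_ham_quad_h, map_smul, MvPolynomial.coeff_smul,
      smul_eq_mul] at hcoeff
    refine (mul_eq_mul_right_iff.1 hcoeff).resolve_left fun hweight => ?_
    rw [Finsupp.degree_eq_sum, Fin.sum_univ_two] at hm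
    have : m 1 = 2 * k + m 0 := by exact_mod_cast sub_eq_iff_eq_add.1 hweight
    omega

theorem bracket_mom_h_mom_e_pow (k : ℕ) :
    bracket (mom h) (mom e ^ k) = (2 * k : ℂ) • mom e ^ k := by
  induction k with
  | zero => simpa using bracket_algebraMap (mom h) 1
  | succ k ih =>
    rw [pow_succ, bracket_mul, ih, bracket_mom_mom, lie_h_e, map_smul]
    push_cast
    simp only [mul_smul_comm]
    rw [mul_comm (mom e)]
    module

theorem eq_top_of_bracket_mom_f_mem {M : Submodule ℂ R} (he : ∀ k : ℕ, mom e ^ k ∈ M)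
    (hf : ∀ r ∈ M, bracket (mom f) r ∈ M) : M = ⊤ := by
  set N := M.map rho.toLinearMap
  have hlower : ∀ F ∈ N, u * dv F ∈ N := by
    rintro _ ⟨r, hr, rfl⟩
    refine ⟨-bracket (mom f) r, neg_mem (hf r hr), ?_⟩
    change rho _ = u * dv (rho r)
    rw [map_neg, rho_bracket, rho_mom, ham_quad_f, neg_neg]
  have hmonomial (i : ℕ) : ∀ j k : ℕ, i + j = 2 * k → u ^ i * v ^ j ∈ N := by
    induction i with
    | zero =>
      intro j k hk
      rw [← zero_add j, hk, pow_zero, one_mul, ← rho_mom_e_pow]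
      exact ⟨_, M.smul_mem _ (he k), rfl⟩
    | succ i ih =>
      intro j k hk
      have hj : ((j : ℂ) + 1) ≠ 0 := Nat.cast_add_one_ne_zero j
      refine (N.smul_mem_iff hj).1 ?_
      convert hlower _ (ih (j + 1) k (by omega)) using 1
      simp only [MvPolynomial.smul_eq_C_mul, Derivation.leibniz, Derivation.leibniz_pow, dv_u, dv_v,
        smul_eq_mul, smul_zero, mul_zero, add_zero, add_tsub_cancel_right, mul_one, nsmul_eq_mul,
        Nat.cast_add_one, map_add, map_one, map_natCast]
      ring
  refine eq_top_iff.2 fun r _ => mem_of_monomial_mem_map_rho fun m hm => ?_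
  obtain ⟨k, hk⟩ := even_iff_two_dvd.1 (even_degree_of_mem_support_rho hm)
  rw [Finsupp.degree_eq_sum, Fin.sum_univ_two] at hk
  rw [monomial_one_fin_two]
  exact hmonomial (m 0) (m 1) k hk

namespace StarProduct

variable {s s' : StarProduct} (hs : s.IsEquivariant) (hs' : s'.IsEquivariant)

-- Both sides have weight `2k` and their difference has degree less than `k`.
theorem psi_eU_pow (k : ℕ) : psi hs (eU ^ k) = mom e ^ k := by
  have hbelow := psi_prod_sub_mem_below hs (List.replicate k e)
  simp only [List.map_replicate, List.prod_replicate, List.length_replicate] at hbelow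
  have hweight : bracket (mom h) (psi hs (eU ^ k)) = (2 * k : ℂ) • psi hs (eU ^ k) := by
    rw [← psi_lie, ← map_smul]
    exact congrArg _ (sub_eq_of_eq_add' (mul_pow_of_weight hU_mul_eU k))
  refine sub_eq_zero.1 (eq_zero_of_mem_below_of_bracket_mom_h hbelow ?_)
  rw [map_sub, bracket_mom_h_mom_e_pow, smul_sub]
  exact congrArg (· - _) hweight

theorem psi_surjective : Function.Surjective (psi hs) := by
  refine LinearMap.range_eq_top.1 (eq_top_of_bracket_mom_f_mem (fun k => ⟨_, psi_eU_pow hs k⟩) ?_)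
  rintro _ ⟨w, rfl⟩
  exact ⟨_, psi_lie hs f w⟩

variable {c : ℂ} (hc : casimir s = algebraMap ℂ R c) (hc' : casimir s' = algebraMap ℂ R c)

include hc hc'

theorem ker_psi_le_of_casimir_eq : LinearMap.ker (psi hs) ≤ LinearMap.ker (psi hs') := fun _ hw =>
  congrArg s'.ofCirc (map_eq_zero_of_psi_eq_zero hs hc (psiHom hs') (psiHom_casU hs' hc') hw)

theorem psi_eq_of_casimir_eq : psi hs = psi hs' := by
  have htop : (LinearMap.eqLocus (psi hs) (psi hs')).map (psi hs) = ⊤ := by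
    refine eq_top_of_bracket_mom_f_mem (fun k => ?_) ?_
    · exact ⟨eU ^ k, (psi_eU_pow hs k).trans (psi_eU_pow hs' k).symm, psi_eU_pow hs k⟩
    · rintro _ ⟨w, hw, rfl⟩
      refine ⟨_, ?_, psi_lie hs f w⟩
      change psi hs _ = psi hs' _
      rw [psi_lie, psi_lie, show psi hs w = psi hs' w from hw]
  ext w
  obtain ⟨w', hw', hww'⟩ : psi hs w ∈ (LinearMap.eqLocus (psi hs) (psi hs')).map (psi hs) :=
    htop ▸ Submodule.mem_top
  have hker : psi hs' (w' - w) = 0 :=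
    ker_psi_le_of_casimir_eq hs hs' hc hc' (LinearMap.sub_mem_ker_iff.2 hww')
  rw [← hww', show psi hs w' = psi hs' w' from hw']
  exact LinearMap.sub_mem_ker_iff.1 hker

end StarProduct

theorem coeff_rho_eq_zero_of_mem_Rgr {d : ℤ} {r : R} (hr : r ∈ Rgr d) {m : Fin 2 →₀ ℕ}
    (hm : (m.degree : ℤ) ≠ 2 * d) : (rho r).coeff m = 0 := by
  rcases lt_or_ge d 0 with h0 | h0
  · rw [Rgr_of_neg h0, Submodule.mem_bot] at hr
    rw [hr, map_zero, MvPolynomial.coeff_zero]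
  · lift d to ℕ using h0
    exact ((mem_Rgr_iff d r).1 hr).coeff_eq_zero (by exact_mod_cast hm)

theorem eq_zero_of_mem_totalGr_of_eval {n : ℤ} {F : R[X]} (hF : F ∈ totalGr n)
    (hF1 : F.eval 1 = 0) : F = 0 := by
  ext p
  apply rho_injective
  ext m
  rw [Polynomial.coeff_zero, map_zero, MvPolynomial.coeff_zero]
  by_cases hm : (m.degree : ℤ) = 2 * (n - p)
  · by_cases hp : p ∈ F.support
    · have hcoeff := congrArg (fun r => (rho r).coeff m) hF1
      simp only [Polynomial.eval_eq_sum, Polynomial.sum, one_pow, mul_one, map_sum,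
        MvPolynomial.coeff_sum, map_zero, MvPolynomial.coeff_zero] at hcoeff
      rwa [Finset.sum_eq_single_of_mem p hp fun q _ hq =>
        coeff_rho_eq_zero_of_mem_Rgr (hF q) (by omega)] at hcoeff
    · rw [Polynomial.notMem_support_iff.1 hp, map_zero, MvPolynomial.coeff_zero]
  · exact coeff_rho_eq_zero_of_mem_Rgr (hF p) hm

namespace StarProduct

variable {s s' : StarProduct}

theorem ext_circ (hcirc : ∀ r r', s.circ r r' = s'.circ r r') : s = s' := by
  have hhom (k l : ℕ) (r : R) (hr : r ∈ Rgr k) (r' : R) (hr' : r' ∈ Rgr l) :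
      s.star (Polynomial.C r) (Polynomial.C r') = s'.star (Polynomial.C r) (Polynomial.C r') := by
    refine sub_eq_zero.1 (eq_zero_of_mem_totalGr_of_eval (n := (k : ℤ) + l) (sub_mem ?_ ?_) ?_)
    · exact fun p => s.graded p k l r hr r' hr'
    · exact fun p => s'.graded p k l r hr r' hr'
    · rw [Polynomial.eval_sub]
      exact sub_eq_zero.2 (hcirc r r')
  let C₀ : R →ₗ[ℂ] R[X] := (Polynomial.monomial 0).restrictScalars ℂ
  have hbilin : s.star.compl₁₂ C₀ C₀ = s'.star.compl₁₂ C₀ C₀ :=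
    end_ext_Rgr fun k r hr => end_ext_Rgr fun l r' hr' => hhom k l r hr r' hr'
  exact ext_C fun r r' => LinearMap.congr_fun₂ hbilin r r'

theorem eq_of_casimir_eq (hs : s.IsEquivariant) (hs' : s'.IsEquivariant) {c : ℂ}
    (hc : casimir s = algebraMap ℂ R c) (hc' : casimir s' = algebraMap ℂ R c) : s = s' := by
  have hpsi := psi_eq_of_casimir_eq hs hs' hc hc'
  refine ext_circ fun r r' => ?_
  obtain ⟨w, rfl⟩ := psi_surjective hs r
  obtain ⟨w', rfl⟩ := psi_surjective hs r'
  rw [← psi_mul, hpsi, psi_mul]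

theorem coeff_one_star_mom (s : StarProduct) (x y : g) :
    (s.star (Polynomial.C (mom x)) (Polynomial.C (mom y))).coeff 1 = (1 / 2 : ℂ) • mom ⁅x, y⁆ := by
  have hskew := s.coeff_one (SymmetricAlgebra.ι ℂ g x) (SymmetricAlgebra.ι ℂ g y)
  rw [← bracket_proj, s.parity 1 (proj (SymmetricAlgebra.ι ℂ g y)), pow_one, neg_one_mul,
    sub_neg_eq_add] at hskew
  have hskew' : (s.star (Polynomial.C (mom x)) (Polynomial.C (mom y))).coeff 1 +
      (s.star (Polynomial.C (mom x)) (Polynomial.C (mom y))).coeff 1 = mom ⁅x, y⁆ :=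
    hskew.trans (bracket_mom_mom x y)
  rw [← hskew', ← two_smul ℂ, smul_smul]
  norm_num

theorem exists_circ_mom_mom (s : StarProduct) (x y : g) : ∃ c : ℂ, s.circ (mom x) (mom y) =
    mom x * mom y + (1 / 2 : ℂ) • mom ⁅x, y⁆ + algebraMap ℂ R c := by
  set F := s.star (Polynomial.C (mom x)) (Polynomial.C (mom y)) with hF
  have hgr (p : ℕ) : F.coeff p ∈ Rgr (((1 : ℕ) : ℤ) + ((1 : ℕ) : ℤ) - p) :=
    s.graded p 1 1 _ (mom_mem_Rgr x) _ (mom_mem_Rgr y)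
  obtain ⟨c, hc⟩ : ∃ c, algebraMap ℂ R c = F.coeff 2 := Submodule.mem_one.1 (Rgr_zero ▸ hgr 2)
  have hdeg : F.natDegree < 3 := by
    rw [Nat.lt_succ_iff, Polynomial.natDegree_le_iff_coeff_eq_zero]
    intro p hp
    have hneg : ((1 : ℕ) : ℤ) + ((1 : ℕ) : ℤ) - p < 0 := by push_cast; omega
    exact (Submodule.mem_bot ℂ).1 (Rgr_of_neg hneg ▸ hgr p)
  refine ⟨c, ?_⟩
  rw [circ, ← hF, Polynomial.eval_eq_sum_range' hdeg]
  simp only [Finset.sum_range_succ, Finset.sum_range_zero, one_pow, mul_one, zero_add, ← hc]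
  rw [hF, coeff_one_star_mom, s.coeff_zero]

theorem exists_casimir_eq (s : StarProduct) : ∃ c : ℂ, casimir s = algebraMap ℂ R c := by
  obtain ⟨c, hc⟩ := exists_circ_mom_mom s h h
  obtain ⟨c', hc'⟩ := exists_circ_mom_mom s e f
  refine ⟨c + 4 * c', ?_⟩
  rw [casimir, hc, hc', lie_self, lie_e_f, map_add, map_mul _ 4, ← Algebra.smul_def, map_zero]
  linear_combination (norm := module) mom_h_sq_add

end StarProduct

/-! ### Twisted differential operators -/

/-- The homomorphism `Φ^l` followed by the inclusion of the twisted differential operators into the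
operators on Laurent polynomials. -/
def PhiOp (l : ℂ) : U →ₐ[ℂ] Op := (twistedDiffOp l).val.comp (Phi l)

theorem mem_J_iff {l : ℂ} {w : U} : w ∈ J l ↔ PhiOp l w = 0 :=
  RingHom.mem_ker.trans Subtype.ext_iff

theorem PhiOp_ι (l : ℂ) (x : g) : PhiOp l (UniversalEnvelopingAlgebra.ι ℂ x) = twistedVF l x :=
  congrArg Subtype.val (UniversalEnvelopingAlgebra.lift_ι_apply ℂ (phiLie l) x)

theorem twistedVF_mk (l a b c : ℂ) (F : ℂ[T;T⁻¹]) : twistedVF l (mk a b c) F =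
    -(LaurentPolynomial.C b + LaurentPolynomial.C (2 * a) * LaurentPolynomial.T 1 -
        LaurentPolynomial.C c * LaurentPolynomial.T 2) * ddz F +
      l • (-(LaurentPolynomial.C (2 * a) - LaurentPolynomial.C (2 * c) * LaurentPolynomial.T 1)
        * F) := by
  rw [twistedVF, ddz_vf]
  rfl

theorem twistedVF_e (l : ℂ) (F : ℂ[T;T⁻¹]) : twistedVF l e F = -ddz F := by
  rw [e_eq, twistedVF_mk]
  simp

theorem twistedVF_h (l : ℂ) (F : ℂ[T;T⁻¹]) : twistedVF l h F =
    -(2 * LaurentPolynomial.T 1 * ddz F) - 2 * LaurentPolynomial.C l * F := by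
  rw [h, twistedVF_mk, LaurentPolynomial.smul_eq_C_mul, mul_zero, map_zero, mul_one, C_two]
  ring

theorem twistedVF_f (l : ℂ) (F : ℂ[T;T⁻¹]) : twistedVF l f F =
    LaurentPolynomial.T 1 * LaurentPolynomial.T 1 * ddz F +
      2 * LaurentPolynomial.C l * LaurentPolynomial.T 1 * F := by
  rw [f, twistedVF_mk, LaurentPolynomial.smul_eq_C_mul, mul_zero, map_zero, mul_one, C_two,
    map_one, ← LaurentPolynomial.T_add, one_add_one_eq_two]
  ring

theorem ddz_C (c : ℂ) : ddz (LaurentPolynomial.C c) = 0 := ddz.map_algebraMap c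

theorem ddz_T_one : ddz (LaurentPolynomial.T 1) = 1 := by
  rw [ddz_T, sub_self, LaurentPolynomial.T_zero, Int.cast_one, map_one, one_mul]

theorem PhiOp_casU (l : ℂ) : PhiOp l casU = algebraMap ℂ Op (4 * l * (l - 1)) := by
  have ddz_two : ddz 2 = 0 := by rw [← C_two, ddz_C]
  apply LinearMap.ext
  intro F
  simp only [casU, eU, hU, fU, map_add, map_sub, map_smul, map_mul, PhiOp_ι]
  rw [← map_mul, ← map_sub, ← map_mul, Module.algebraMap_end_apply]
  simp only [LinearMap.add_apply, LinearMap.sub_apply, LinearMap.smul_apply, Module.End.mul_apply,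
    twistedVF_e, twistedVF_h, twistedVF_f, LaurentPolynomial.smul_eq_C_mul, map_add, map_sub,
    map_neg, Derivation.leibniz, ddz_T_one, ddz_C, ddz_two, smul_eq_mul, map_mul, C_two,
    map_ofNat LaurentPolynomial.C 4, map_one]
  ring

theorem PhiOp_eU_pow_T (l : ℂ) (k : ℕ) : PhiOp l (eU ^ k) (LaurentPolynomial.T (-1)) =
    (k.factorial : ℂ) • LaurentPolynomial.T (-1 - k) := by
  induction k with
  | zero => simp
  | succ k ih =>
    have hcoeff : -((-1 - k : ℤ) : ℂ) = k + 1 := by push_cast; ring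
    rw [pow_succ', map_mul, Module.End.mul_apply, ih, eU, PhiOp_ι, twistedVF_e, Derivation.map_smul,
      ddz_T, ← LaurentPolynomial.smul_eq_C_mul, ← smul_neg, ← neg_smul, hcoeff,
      smul_smul, Nat.factorial_succ, mul_comm, sub_sub, Nat.cast_mul, Nat.cast_add_one,
      Nat.cast_add_one]

theorem linearIndependent_T : LinearIndependent ℂ (LaurentPolynomial.T : ℤ → ℂ[T;T⁻¹]) :=
  .of_comp (AddMonoidAlgebra.coeffLinearEquiv ℂ).toLinearMap
    (Finsupp.linearIndependent_single_one ℂ ℤ)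

theorem linearIndependent_PhiOp_eU_pow (l : ℂ) :
    LinearIndependent ℂ fun k : ℕ => PhiOp l (eU ^ k) := by
  refine .of_comp (LinearMap.applyₗ (LaurentPolynomial.T (-1))) ?_
  have hT : LinearIndependent ℂ fun k : ℕ => (LaurentPolynomial.T (-1 - k) : ℂ[T;T⁻¹]) :=
    linearIndependent_T.comp _ fun k k' (hk : (-1 - k : ℤ) = -1 - k') => by omega
  convert hT.units_smul fun k => .mk0 (k.factorial : ℂ) (Nat.cast_ne_zero.2 k.factorial_ne_zero)
    using 1
  exact funext (PhiOp_eU_pow_T l)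

theorem exists_ham_quad_e_pow_eq_zero (F : P) :
    ∃ n : ℕ, ((ham (quad e)).toLinearMap ^ n) F = 0 := by
  let N := Module.End.maxGenEigenspace (ham (quad e)).toLinearMap 0
  have mem_N {F : P} : F ∈ N ↔ ∃ n : ℕ, ((ham (quad e)).toLinearMap ^ n) F = 0 := by
    rw [Module.End.mem_maxGenEigenspace, zero_smul, sub_zero]
  have mem_of_ham_mem {F : P} (hF : ham (quad e) F ∈ N) : F ∈ N := by
    obtain ⟨n, hn⟩ := mem_N.1 hF
    exact mem_N.2 ⟨n + 1, by rwa [pow_succ, Module.End.mul_apply]⟩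
  have monomial_mem (i : ℕ) : ∀ j, u ^ i * v ^ j ∈ N := by
    induction i with
    | zero =>
      refine fun j => mem_of_ham_mem ?_
      rw [ham_quad_e]
      simp [Derivation.leibniz_pow]
    | succ i ih =>
      refine fun j => mem_of_ham_mem ?_
      convert N.smul_mem (-((i : ℂ) + 1)) (ih (j + 1)) using 1
      rw [ham_quad_e, MvPolynomial.smul_eq_C_mul]
      simp only [Derivation.leibniz, Derivation.leibniz_pow, du_u, du_v, smul_eq_mul, smul_zero,
        mul_zero, zero_add, add_tsub_cancel_right, mul_one, nsmul_eq_mul, Nat.cast_add_one,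
        map_neg, map_add, map_one, map_natCast]
      ring
  exact mem_N.1 (mem_of_monomial_mem fun m _ => monomial_one_fin_two (K := ℂ) m ▸ monomial_mem _ _)

theorem exists_bracket_mom_e_pow_eq_zero (r : R) : ∃ n : ℕ, (bracket (mom e) ^ n) r = 0 := by
  obtain ⟨n, hn⟩ := exists_ham_quad_e_pow_eq_zero (rho r)
  have hcomm : (ham (quad e)).toLinearMap ∘ₗ rho.toLinearMap =
      rho.toLinearMap ∘ₗ bracket (mom e) :=
    LinearMap.ext fun r => (rho_mom e ▸ rho_bracket (mom e) r).symm
  refine ⟨n, rho_injective ?_⟩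
  rw [map_zero, ← hn]
  exact (LinearMap.congr_fun (Module.End.commute_pow_left_of_commute hcomm n) r).symm

theorem mem_span_of_bracket_mom_e_eq_zero {r : R} (hr : bracket (mom e) r = 0) :
    r ∈ Submodule.span ℂ (Set.range fun k : ℕ => mom e ^ k) := by
  have hdu : du (rho r) = 0 := by
    have hham := rho_bracket (mom e) r
    rw [hr, map_zero, rho_mom, ham_quad_e, zero_eq_neg] at hham
    exact (mul_eq_zero.1 hham).resolve_left (MvPolynomial.X_ne_zero 1)
  refine mem_of_monomial_mem_map_rho fun m hm => ?_
  have hm0 : m 0 = 0 := by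
    have hcoeff := coeff_X_mul_pderiv 0 (rho r) m
    rw [hdu, mul_zero, MvPolynomial.coeff_zero] at hcoeff
    exact_mod_cast (mul_eq_zero.1 hcoeff.symm).resolve_right (MvPolynomial.mem_support_iff.1 hm)
  obtain ⟨k, hk⟩ := even_iff_two_dvd.1 (even_degree_of_mem_support_rho hm)
  rw [Finsupp.degree_eq_sum, Fin.sum_univ_two, hm0, zero_add] at hk
  rw [monomial_one_fin_two, hm0, hk, pow_zero, one_mul, ← rho_mom_e_pow]
  exact ⟨_, Submodule.smul_mem _ _ (Submodule.subset_span ⟨k, rfl⟩), rfl⟩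

namespace StarProduct

variable {s : StarProduct} (hs : s.IsEquivariant)

section

variable {l : ℂ} (hc : casimir s = algebraMap ℂ R (4 * l * (l - 1)))

include hc

theorem PhiOp_eq_zero_of_psi_eq_zero {w : U} (hw : psi hs w = 0) : PhiOp l w = 0 :=
  map_eq_zero_of_psi_eq_zero hs hc (PhiOp l) (PhiOp_casU l) hw

theorem psi_eq_zero_of_PhiOp_eq_zero_of_bracket_mom_e {w : U} (hw : PhiOp l w = 0)
    (he : bracket (mom e) (psi hs w) = 0) : psi hs w = 0 := by
  obtain ⟨a, ha⟩ : ∃ a, Finsupp.linearCombination ℂ (fun k : ℕ => mom e ^ k) a = psi hs w :=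
    Finsupp.mem_span_range_iff_exists_finsupp.1 (mem_span_of_bracket_mom_e_eq_zero he)
  set w' := Finsupp.linearCombination ℂ (fun k : ℕ => eU ^ k) a
  have hpsi : psi hs w' = psi hs w := by
    rw [← ha, Finsupp.apply_linearCombination]
    exact congrArg (Finsupp.linearCombination ℂ · a) (funext (psi_eU_pow hs))
  have hPhi : PhiOp l w' = 0 := by
    rw [← hw, ← sub_eq_zero, ← map_sub]
    exact PhiOp_eq_zero_of_psi_eq_zero hs hc (LinearMap.sub_mem_ker_iff.2 hpsi)
  have ha0 : a = 0 := linearIndependent_iff.1 (linearIndependent_PhiOp_eU_pow l) a <|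
    (Finsupp.apply_linearCombination ℂ (PhiOp l).toLinearMap _ a).symm.trans hPhi
  rw [← ha, ha0, map_zero]

-- The kernel of `Φ^l` is stable under `ad e`, and `ad e` acts locally nilpotently on `R`.
theorem psi_eq_zero_of_PhiOp_eq_zero {w : U} (hw : PhiOp l w = 0) : psi hs w = 0 := by
  obtain ⟨n, hn⟩ := exists_bracket_mom_e_pow_eq_zero (psi hs w)
  induction n generalizing w with
  | zero => exact hn
  | succ n ih =>
    refine psi_eq_zero_of_PhiOp_eq_zero_of_bracket_mom_e hs hc hw ?_
    rw [← psi_lie]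
    apply ih
    · rw [LieRing.of_associative_ring_bracket, map_sub, map_mul, map_mul, hw, mul_zero, zero_mul,
        sub_zero]
    · rwa [psi_lie, ← Module.End.mul_apply, ← pow_succ]

end

include hs in
theorem correspondsTo_J_iff (l : ℂ) :
    s.CorrespondsTo (J l) ↔ casimir s = algebraMap ℂ R (4 * l * (l - 1)) := by
  constructor
  · rintro ⟨Ψ, h1, hmul, hι, hJ⟩
    have hcas : casU - algebraMap ℂ U (4 * l * (l - 1)) ∈ J l :=
      mem_J_iff.2 (by rw [map_sub, PhiOp_casU, AlgHom.commutes, sub_self])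
    rwa [hJ, eq_psi hs h1 hmul hι, map_sub, psi_casU, psi_algebraMap, sub_eq_zero] at hcas
  · intro hc
    exact ⟨psi hs, psi_one hs, psi_mul hs, psi_ι hs, fun w => mem_J_iff.trans
      ⟨psi_eq_zero_of_PhiOp_eq_zero hs hc, PhiOp_eq_zero_of_psi_eq_zero hs hc⟩⟩

end StarProduct

/-- The star product `⋆_l` corresponding to `J^l`. -/
def starOf (l : ℂ) : StarProduct := starProduct (4 * (2 * l - 1) ^ 2)

theorem starOf_isEquivariant (l : ℂ) : (starOf l).IsEquivariant := starProduct_isEquivariant _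

theorem casimir_starOf (l : ℂ) : casimir (starOf l) = algebraMap ℂ R (4 * l * (l - 1)) := by
  rw [starOf, casimir_starProduct]
  congr 1
  ring

theorem casimir_injOn : Set.InjOn casimir {s | s.IsEquivariant} := fun s hs _ hs' heq =>
  have ⟨_, hc⟩ := s.exists_casimir_eq
  StarProduct.eq_of_casimir_eq hs hs' hc (heq ▸ hc)

theorem correspondsTo_J_iff_eq_starOf {s : StarProduct} (hs : s.IsEquivariant) (l : ℂ) :
    s.CorrespondsTo (J l) ↔ s = starOf l := by
  rw [StarProduct.correspondsTo_J_iff hs, ← casimir_starOf]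
  exact casimir_injOn.eq_iff hs (starOf_isEquivariant l)

theorem exists_eq_starOf {s : StarProduct} (hs : s.IsEquivariant) : ∃ l : ℂ, s = starOf l := by
  obtain ⟨c, hc⟩ := s.exists_casimir_eq
  obtain ⟨z, hz⟩ := IsAlgClosed.exists_pow_nat_eq (c + 1) two_pos
  refine ⟨(z + 1) / 2, StarProduct.eq_of_casimir_eq hs (starOf_isEquivariant _) hc ?_⟩
  rw [casimir_starOf]
  congr 1
  linear_combination hz

instance : Nontrivial R := rho.toRingHom.domain_nontrivial

theorem starOf_eq_starOf_iff (l m : ℂ) : starOf l = starOf m ↔ m = l ∨ m = 1 - l := by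
  have hcasimir := casimir_injOn.eq_iff (starOf_isEquivariant l) (starOf_isEquivariant m)
  rw [← hcasimir, casimir_starOf, casimir_starOf, (algebraMap ℂ R).injective.eq_iff,
    ← sub_eq_zero (a := m), ← sub_eq_zero (a := m), ← mul_eq_zero]
  constructor <;> intro hlm
  · linear_combination -hlm / 4
  · linear_combination -4 * hlm

end SlTwo

end

/-- There is a family `⋆_l` of `G`-equivariant graded star products on `R`, indexed by complex
numbers, such that `⋆_l` is the unique one corresponding to `J^l = Ker Φ^l`, such that every
`G`-equivariant graded star product on `R` is some `⋆_l`, and such that `⋆_l = ⋆_m` if and only if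
`m = ±(l - 1/2) + 1/2`. -/
theorem corollary3p2 :
    ∃ starOf : ℂ → SlTwo.StarProduct,
      (∀ l : ℂ, (starOf l).IsEquivariant) ∧
      (∀ (l : ℂ) (s : SlTwo.StarProduct), s.IsEquivariant →
        (s.CorrespondsTo (SlTwo.J l) ↔ s = starOf l)) ∧
      (∀ s : SlTwo.StarProduct, s.IsEquivariant → ∃ l : ℂ, s = starOf l) ∧
      (∀ l m : ℂ, starOf l = starOf m ↔ m = l ∨ m = 1 - l) :=
  ⟨SlTwo.starOf, SlTwo.starOf_isEquivariant,
    fun l _ hs => SlTwo.correspondsTo_J_iff_eq_starOf hs l,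
    fun _ hs => SlTwo.exists_eq_starOf hs, SlTwo.starOf_eq_starOf_iff⟩
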